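/- Let $M$ be a compact smooth manifold of dimension $n\ge 1$, possibly with boundary, and let $T^*M\setminus 0$ be its cotangent bundle without the zero section. Let $\alpha$ be the canonical 1-form on $T^*M$, $\omega=d\alpha$ and $\Omega=\alpha\wedge(d\alpha)^{n-1}/n!$. A *star Hamiltonian* is a continuous proper function $H:T^*M\to[0,\infty)$ that is positive outside the zero section and satisfies $H(tp)=tH(p)$ for $t>0$; a *star body* is a set $A=\{H\le 1\}$ with $H$ a star Hamiltonian, and its radial function is $\rho_A=1/H$ on $T^*M\setminus 0$. The *radial sum* $A\,\tilde{+}\,B$ of two star bodies is the star body with radial function $\rho_A+\rho_B$. Put $V(A)=\int_A\omega^n/n!$ and, for star bodies $A_1,\dots,A_n$, $$\tilde V(A_1,\dots,A_n)=\int_{\partial U}\rho_{A_1}\cdots\rho_{A_n}\,\Omega ,$$ where $U=\{H_0\le 1\}$ is a model star body whose Hamiltonian $H_0$ is smooth outside the zero section and $\partial U=\{H_0=1\}$ (the value does not depend on $U$). Here $T^*M$ and $\partial U$ are oriented so that $\omega^n$ and $\Omega|_{\partial U}$ are positive. Let $\varphi:T^*M\setminus 0\to T^*M\setminus 0$ be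 a *special homogeneous transformation*, that is, a diffeomorphism with $\varphi(tp)=t\varphi(p)$ for $t>0$ and $\varphi^*\Omega=\Omega$. For a star body $A$, let $\varphi(A)$ denote the image of $A\setminus 0$ under $\varphi$ together with the zero section. Then: 1. If $A$ is a star body, so is $\varphi(A)$, and for all star bodies $A,B$ one has $V(A\,\tilde{+}\,B)=V(\varphi(A)\,\tilde{+}\,\varphi(B))$. 2. For all star bodies $A_1,\dots,A_n$ one has $\tilde V(A_1,\dots,A_n)=\tilde V(\varphi(A_1),\dots,\varphi(A_n))$, where the two sides may be computed with different model bodies. 3. If $A_1,\dots,A_n$ and $B_1,\dots,B_n$ are star bodies with $\varphi(A_i)\subset B_i$ for all $i$, then $\tilde V(A_1,\dots,A_n)\le\tilde V(B_1,\dots,B_n)$, where again the two sides may be computed with different model bodies. -/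

import Mathlib

open Set MeasureTheory Bundle
open scoped Manifold ContDiff ENNReal

noncomputable section

/-! ### Exterior algebra -/

/-- The exterior product of two alternating forms on a real vector space (sum over shuffles, so
that `(a ∧ b) (v, w) = a v * b w - a w * b v` for 1-forms). -/
def wedgeProduct {V : Type*} [AddCommGroup V] [Module ℝ V] {k l : ℕ}
    (a : V [⋀^Fin k]→ₗ[ℝ] ℝ) (b : V [⋀^Fin l]→ₗ[ℝ] ℝ) : V [⋀^Fin (k + l)]→ₗ[ℝ] ℝ :=
  ((LinearMap.mul' ℝ ℝ).compAlternatingMap (a.domCoprod b)).domDomCongr finSumFinEquiv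

/-- The `k`-th exterior power `w ∧ ⋯ ∧ w` of a 2-form `w`. -/
def wedgePower {V : Type*} [AddCommGroup V] [Module ℝ V] (w : V [⋀^Fin 2]→ₗ[ℝ] ℝ) :
    (k : ℕ) → V [⋀^Fin (2 * k)]→ₗ[ℝ] ℝ
  | 0 => AlternatingMap.constOfIsEmpty ℝ V (Fin 0) 1
  | k + 1 => wedgeProduct (wedgePower w k) w

/-! ### Differential forms on manifolds: exterior derivative and integration -/

section Forms

variable {F : Type*} [NormedAddCommGroup F] [NormedSpace ℝ F] {G : Type*} [TopologicalSpace G]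
  (J : ModelWithCorners ℝ F G) {N : Type*} [TopologicalSpace N] [ChartedSpace G N]

/-- The exterior derivative of a differential `k`-form on a manifold: at the point `p`, write the
form in the chart around `p`, take its exterior derivative there, and pull the result back. -/
def manifoldExtDeriv {k : ℕ} (η : (p : N) → TangentSpace J p [⋀^Fin k]→L[ℝ] ℝ) (p : N) :
    TangentSpace J p [⋀^Fin (k + 1)]→L[ℝ] ℝ :=
  let inChart : F → F [⋀^Fin k]→L[ℝ] ℝ := fun y =>
    (η ((extChartAt J p).symm y)).compContinuousLinearMap
      (mfderivWithin 𝓘(ℝ, F) J (extChartAt J p).symm (range J) y)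
  let d : F [⋀^Fin (k + 1)]→L[ℝ] ℝ := extDerivWithin inChart (range J) (extChartAt J p p)
  d.compContinuousLinearMap (mfderiv J 𝓘(ℝ, F) (extChartAt J p) p)

/-- `σ`, restricted to the open set `D ⊆ ℝᵐ`, is a smooth regular (injective, immersive)
parametrization of a part of the subset `S` of a manifold. -/
structure IsLocalParametrization (S : Set N) {m : ℕ} (D : Set (Fin m → ℝ))
    (σ : (Fin m → ℝ) → N) : Prop where
  isOpen : IsOpen D
  smooth : ContMDiffOn 𝓘(ℝ, Fin m → ℝ) J ∞ σ D
  injOn : InjOn σ D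
  mapsTo : MapsTo σ D S
  immersive : ∀ u ∈ D, Function.Injective (mfderiv 𝓘(ℝ, Fin m → ℝ) J σ u)

/-- The coefficient `(σ^* η)(∂₁, …, ∂ₘ) = η (∂₁σ, …, ∂ₘσ)` of the pull-back of an `m`-form `η`
under a map `σ` defined on `ℝᵐ`. -/
def pullbackCoefficient {m : ℕ} (η : (p : N) → TangentSpace J p [⋀^Fin m]→ₗ[ℝ] ℝ)
    (σ : (Fin m → ℝ) → N) (u : Fin m → ℝ) : ℝ :=
  η (σ u) fun i => mfderiv 𝓘(ℝ, Fin m → ℝ) J σ u (Pi.single i (1 : ℝ) : Fin m → ℝ)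

/-- The measure on an `m`-dimensional submanifold `S` (possibly with boundary) that is given by an
`m`-form `η` which restricts to a volume form of `S`, where `S` carries the orientation for which
`η` is positive; it is regarded as a measure on the ambient manifold. For every local
parametrization `σ : D → S` its restriction to `σ(D)` is the image under `σ` of the measure
`|η(∂₁σ, …, ∂ₘσ)| du₁ ⋯ duₘ` on `D`. By the change of variables formula these local measures agree
on overlaps, so that the measure which they define together is their supremum, that is, the
smallest measure that dominates all of them. (Parametrizations by open subsets of `ℝᵐ` reach
all of `S` but its boundary, which is a null set.) -/
def formMeasure [MeasurableSpace N] (S : Set N) {m : ℕ}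
    (η : (p : N) → TangentSpace J p [⋀^Fin m]→ₗ[ℝ] ℝ) : Measure N :=
  ⨆ (D : Set (Fin m → ℝ)) (σ : (Fin m → ℝ) → N) (_ : IsLocalParametrization J S D σ),
    ((volume.restrict D).withDensity
      fun u => ENNReal.ofReal |pullbackCoefficient J η σ u|).map σ

end Forms

/-! ### The cotangent bundle, its canonical forms and its symplectic volume -/

section Cotangent

variable {E : Type*} [NormedAddCommGroup E] [NormedSpace ℝ E] {H : Type*} [TopologicalSpace H]

/-- The cotangent bundle `T*M`; its points are pairs `⟨x, ξ⟩` with `ξ` a linear form on `T_x M`. -/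
abbrev CotangentBundle (I : ModelWithCorners ℝ E H) (M : Type*) [TopologicalSpace M]
    [ChartedSpace H M] : Type _ :=
  TotalSpace (E →L[ℝ] ℝ) (fun x : M => TangentSpace I x →L[ℝ] ℝ)

/-- The model with corners of `T*M`. -/
abbrev cotangentModel (I : ModelWithCorners ℝ E H) :
    ModelWithCorners ℝ (E × (E →L[ℝ] ℝ)) (ModelProd H (E →L[ℝ] ℝ)) :=
  I.prod 𝓘(ℝ, E →L[ℝ] ℝ)

variable (I : ModelWithCorners ℝ E H) (M : Type*) [TopologicalSpace M] [ChartedSpace H M]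

/-- `T*M ∖ 0`, the complement of the zero section. -/
def nonzeroCovectors : Set (CotangentBundle I M) := {p | p.2 ≠ 0}

variable [IsManifold I ∞ M]

instance : MeasurableSpace (CotangentBundle I M) := borel _

instance : BorelSpace (CotangentBundle I M) := ⟨rfl⟩

variable {I M}

/-- The canonical 1-form `α` on `T*M`: `α_p(v) = p(π_* v)`. -/
def canonicalForm (p : CotangentBundle I M) :
    TangentSpace (cotangentModel I) p [⋀^Fin 1]→L[ℝ] ℝ :=
  ContinuousAlternatingMap.ofSubsingleton ℝ (TangentSpace (cotangentModel I) p) ℝ (0 : Fin 1)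
    (p.2.comp (mfderiv (cotangentModel I) I
      (TotalSpace.proj : CotangentBundle I M → M) p))

/-- The symplectic form `ω = dα` on `T*M`. -/
def symplecticForm (p : CotangentBundle I M) :
    TangentSpace (cotangentModel I) p [⋀^Fin 2]→L[ℝ] ℝ :=
  manifoldExtDeriv (cotangentModel I) canonicalForm p

/-- The Liouville volume form `ωⁿ / n!` on `T*M`, for `n = dim M`. -/
def liouvilleForm (n : ℕ) (p : CotangentBundle I M) :
    TangentSpace (cotangentModel I) p [⋀^Fin (2 * n)]→ₗ[ℝ] ℝ :=
  (n.factorial : ℝ)⁻¹ • wedgePower (symplecticForm p).toAlternatingMap n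

/-- The form `Ω = α ∧ (dα)ⁿ⁻¹ / n!` on `T*M`, for `n = dim M ≥ 1`. -/
def omegaForm (n : ℕ) (p : CotangentBundle I M) :
    TangentSpace (cotangentModel I) p [⋀^Fin (1 + 2 * (n - 1))]→ₗ[ℝ] ℝ :=
  (n.factorial : ℝ)⁻¹ • wedgeProduct (canonicalForm p).toAlternatingMap
    (wedgePower (symplecticForm p).toAlternatingMap (n - 1))

/-- The symplectic volume `V(A) = ∫_A ωⁿ / n!` of a subset of `T*M`, `n = dim M` (where `T*M` is
oriented by `ωⁿ`). -/
def symplecticVolume (n : ℕ) (A : Set (CotangentBundle I M)) : ℝ≥0∞ :=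
  formMeasure (cotangentModel I) univ (liouvilleForm n) A

end Cotangent

/-! ### Star bodies, radial sums, dual mixed volumes -/

section StarBodies

variable {E : Type*} [NormedAddCommGroup E] [NormedSpace ℝ E] {H : Type*} [TopologicalSpace H]
  {I : ModelWithCorners ℝ E H} {M : Type*} [TopologicalSpace M] [ChartedSpace H M]

/-- The covector `t p` over the same base point as `p`. -/
def scaleCovector (t : ℝ) (p : CotangentBundle I M) : CotangentBundle I M := ⟨p.1, t • p.2⟩

/-- The radial function `ρ_A` of a set of covectors: `ρ_A(p)` is the largest `t` with `t p ∈ A`.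
If `A = {h ≤ 1}` for a star Hamiltonian `h`, then `ρ_A = 1 / h` outside the zero section; the radial
function of `A` with respect to a model body `U` is the restriction of `ρ_A` to `∂U`. -/
def radialFunction (A : Set (CotangentBundle I M)) (p : CotangentBundle I M) : ℝ :=
  sSup {t : ℝ | 0 < t ∧ scaleCovector t p ∈ A}

/-- The radial sum of two star bodies: the star body with radial function `ρ_A + ρ_B`. -/
def radialSum (A B : Set (CotangentBundle I M)) : Set (CotangentBundle I M) :=
  {p | p.2 = 0 ∨ 1 ≤ radialFunction A p + radialFunction B p}

/-- The image `φ(A)` of a star body under a transformation of `T*M ∖ 0`; the zero section, where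
`φ` is not defined, belongs to every star body. -/
def transformBody (φ : PartialEquiv (CotangentBundle I M) (CotangentBundle I M))
    (A : Set (CotangentBundle I M)) : Set (CotangentBundle I M) :=
  φ '' (A ∩ nonzeroCovectors I M) ∪ {p | p.2 = 0}

variable [IsManifold I ∞ M]

/-- A star Hamiltonian on `T*M`. -/
structure IsStarHamiltonian (h : CotangentBundle I M → ℝ) : Prop where
  continuous : Continuous h
  nonneg : ∀ p, 0 ≤ h p
  pos : ∀ p ∈ nonzeroCovectors I M, 0 < h p
  homogeneous : ∀ (t : ℝ) (p : CotangentBundle I M), 0 < t → h (scaleCovector t p) = t * h p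
  proper : IsProperMap h

/-- A star Hamiltonian that is smooth outside the zero section. -/
structure IsSmoothStarHamiltonian (h : CotangentBundle I M → ℝ) : Prop
    extends IsStarHamiltonian h where
  smooth : ContMDiffOn (cotangentModel I) 𝓘(ℝ, ℝ) ∞ h (nonzeroCovectors I M)

/-- A star body in `T*M` is a set of the form `{p | h p ≤ 1}` for a star Hamiltonian `h`. -/
def IsStarBody (A : Set (CotangentBundle I M)) : Prop :=
  ∃ h : CotangentBundle I M → ℝ, IsStarHamiltonian h ∧ A = {p | h p ≤ 1}

/-- The dual mixed volume `∫_{∂U} ρ₁ ⋯ ρₙ Ω` of `n` star bodies `A₁, …, Aₙ`, `n = dim M`, computed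
with the model body `U = {h₀ ≤ 1}` whose Hamiltonian `h₀` is smooth, so that `∂U = {h₀ = 1}` is a
smooth hypersurface (transversal to the rays); `Ω` restricts to a positive volume form on `∂U`,
oriented as the boundary of `U`. -/
def dualMixedVolume (n : ℕ) (h₀ : CotangentBundle I M → ℝ)
    (A : Fin n → Set (CotangentBundle I M)) : ℝ≥0∞ :=
  ∫⁻ p, ENNReal.ofReal (∏ i, radialFunction (A i) p)
    ∂(formMeasure (cotangentModel I) {p | h₀ p = 1} (omegaForm n))

/-- A special homogeneous transformation of `T*M ∖ 0`, where `n = dim M`: a diffeomorphism of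
`T*M ∖ 0` that is positively homogeneous of degree one and preserves the form `Ω`. -/
structure IsSpecialHomogeneous (n : ℕ)
    (φ : PartialEquiv (CotangentBundle I M) (CotangentBundle I M)) : Prop where
  source_eq : φ.source = nonzeroCovectors I M
  target_eq : φ.target = nonzeroCovectors I M
  smooth : ContMDiffOn (cotangentModel I) (cotangentModel I) ∞ φ (nonzeroCovectors I M)
  smooth_symm : ContMDiffOn (cotangentModel I) (cotangentModel I) ∞ φ.symm (nonzeroCovectors I M)
  homogeneous : ∀ p ∈ nonzeroCovectors I M, ∀ t : ℝ, 0 < t →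
    φ (scaleCovector t p) = scaleCovector t (φ p)
  preserves : ∀ p ∈ nonzeroCovectors I M,
    ∀ v : Fin (1 + 2 * (n - 1)) → TangentSpace (cotangentModel I) p,
      omegaForm n (φ p)
        (fun i => mfderiv (cotangentModel I) (cotangentModel I) φ p (v i)) = omegaForm n p v

theorem radialFunction_sublevel {h : CotangentBundle I M → ℝ} (hh : IsStarHamiltonian h)
    {p : CotangentBundle I M} (hp : p ∈ nonzeroCovectors I M) :
    radialFunction {q | h q ≤ 1} p = 1 / h p := by
  have h0 := hh.pos p hp
  have : {t : ℝ | 0 < t ∧ scaleCovector t p ∈ {q | h q ≤ 1}} = Ioc 0 (1 / h p) := by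
    ext t
    simp only [mem_ofPred_eq, mem_Ioc]
    refine and_congr_right fun ht => ?_
    rw [hh.homogeneous t p ht, le_div_iff₀ h0]
  rw [radialFunction, this, csSup_Ioc (by positivity)]

end StarBodies

end

noncomputable section

section ExteriorAlgebra

variable {V : Type*} [AddCommGroup V] [Module ℝ V]

/-- A bilinear form as a multilinear map in two variables. -/
def bilinToMultilinear (b : V →ₗ[ℝ] V →ₗ[ℝ] ℝ) : MultilinearMap ℝ (fun _ : Fin 2 => V) ℝ where
  toFun v := b (v 0) (v 1)
  map_update_add' v i x y := by
    fin_cases i <;> simp [Function.update]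
  map_update_smul' v i c x := by
    fin_cases i <;> simp [Function.update]

/-- The even position `2 * i` in `Fin (2 * k)`. -/
def evenIdx {k : ℕ} (i : Fin k) : Fin (2 * k) := ⟨2 * i, by omega⟩

/-- The odd position `2 * i + 1` in `Fin (2 * k)`. -/
def oddIdx {k : ℕ} (i : Fin k) : Fin (2 * k) := ⟨2 * i + 1, by omega⟩

theorem evenIdx_injective {k : ℕ} : Function.Injective (evenIdx (k := k)) := fun i j h =>
  Fin.ext (by have := congrArg Fin.val h; simp only [evenIdx] at this; omega)

theorem oddIdx_injective {k : ℕ} : Function.Injective (oddIdx (k := k)) := fun i j h =>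
  Fin.ext (by have := congrArg Fin.val h; simp only [oddIdx] at this; omega)

theorem evenIdx_ne_oddIdx {k : ℕ} (i j : Fin k) : evenIdx i ≠ oddIdx j := fun h => by
  have := congrArg Fin.val h; simp only [oddIdx, evenIdx] at this; omega

/-- The tensor power `b ⊗ ⋯ ⊗ b` of a bilinear form. -/
def bilinPower (b : V →ₗ[ℝ] V →ₗ[ℝ] ℝ) : (k : ℕ) → MultilinearMap ℝ (fun _ : Fin (2 * k) => V) ℝ
  | 0 => MultilinearMap.constOfIsEmpty (ι := Fin 0) ℝ _ 1
  | k + 1 => ((LinearMap.mul' ℝ ℝ).compMultilinearMap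
      ((bilinPower b k).domCoprod (bilinToMultilinear b))).domDomCongr finSumFinEquiv

theorem bilinPower_apply (b : V →ₗ[ℝ] V →ₗ[ℝ] ℝ) (k : ℕ) (v : Fin (2 * k) → V) :
    bilinPower b k v = ∏ i : Fin k, b (v (evenIdx i)) (v (oddIdx i)) := by
  induction k with
  | zero => simp [bilinPower]
  | succ k ih =>
    rw [Fin.prod_univ_castSucc]
    simp only [bilinPower, MultilinearMap.domDomCongr_apply, LinearMap.compMultilinearMap_apply,
      MultilinearMap.domCoprod_apply, LinearMap.mul'_apply, ih]
    rfl

/-- The alternating form `(x, y) ↦ b x y - b y x`. -/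
def bilinAlt (b : V →ₗ[ℝ] V →ₗ[ℝ] ℝ) : V [⋀^Fin 2]→ₗ[ℝ] ℝ :=
  MultilinearMap.alternatization (bilinToMultilinear b)

theorem bilinAlt_apply (b : V →ₗ[ℝ] V →ₗ[ℝ] ℝ) (v : Fin 2 → V) :
    bilinAlt b v = b (v 0) (v 1) - b (v 1) (v 0) := by
  have : (Finset.univ : Finset (Equiv.Perm (Fin 2))) = {1, Equiv.swap 0 1} := by decide
  rw [bilinAlt, MultilinearMap.alternatization_apply, this, Finset.sum_pair (by decide)]
  simp [bilinToMultilinear, sub_eq_add_neg]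

theorem wedgeProduct_alternatization {k l : ℕ} (a : MultilinearMap ℝ (fun _ : Fin k => V) ℝ)
    (b : MultilinearMap ℝ (fun _ : Fin l => V) ℝ) :
    wedgeProduct (MultilinearMap.alternatization a) (MultilinearMap.alternatization b) =
      MultilinearMap.alternatization
        (((LinearMap.mul' ℝ ℝ).compMultilinearMap (a.domCoprod b)).domDomCongr finSumFinEquiv) := by
  rw [wedgeProduct, ← MultilinearMap.domCoprod_alternization,
    ← LinearMap.compMultilinearMap_alternatization]
  ext v
  simp only [AlternatingMap.domDomCongr_apply, MultilinearMap.alternatization_apply,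
    MultilinearMap.domDomCongr_apply]
  refine Fintype.sum_equiv finSumFinEquiv.permCongr _ _ fun σ => ?_
  simp [Equiv.Perm.sign_permCongr]

theorem wedgePower_bilinAlt (b : V →ₗ[ℝ] V →ₗ[ℝ] ℝ) (k : ℕ) :
    wedgePower (bilinAlt b) k = MultilinearMap.alternatization (bilinPower b k) := by
  induction k with
  | zero => 
    ext v
    have : Unique (Equiv.Perm (Fin (2 * 0))) := inferInstanceAs (Unique (Equiv.Perm (Fin 0)))
    rw [MultilinearMap.alternatization_apply, Fintype.sum_unique, Unique.eq_default 1 |>.symm]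
    simp [wedgePower, bilinPower]
  | succ k ih => rw [wedgePower, ih, bilinAlt, wedgeProduct_alternatization]; rfl

/-- A linear form as an alternating map in one variable. -/
def linAlt (a : V →ₗ[ℝ] ℝ) : V [⋀^Fin 1]→ₗ[ℝ] ℝ := AlternatingMap.ofSubsingleton ℝ V ℝ 0 a

theorem wedgePower_apply (b : V →ₗ[ℝ] V →ₗ[ℝ] ℝ) (k : ℕ) (v : Fin (2 * k) → V) :
    wedgePower (bilinAlt b) k v = ∑ σ : Equiv.Perm (Fin (2 * k)), (Equiv.Perm.sign σ : ℝ) *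
      ∏ i : Fin k, b (v (σ (evenIdx i))) (v (σ (oddIdx i))) := by
  rw [wedgePower_bilinAlt, MultilinearMap.alternatization_apply]
  refine Finset.sum_congr rfl fun σ _ => ?_
  rw [MultilinearMap.domDomCongr_apply, bilinPower_apply, Units.smul_def, zsmul_eq_mul]

theorem linAlt_wedge_apply (a : V →ₗ[ℝ] ℝ) (b : V →ₗ[ℝ] V →ₗ[ℝ] ℝ) (k : ℕ)
    (v : Fin (1 + 2 * k) → V) :
    wedgeProduct (linAlt a) (wedgePower (bilinAlt b) k) v =
      ∑ σ : Equiv.Perm (Fin (1 + 2 * k)), (Equiv.Perm.sign σ : ℝ) * (a (v (σ (Fin.castAdd (2 * k) 0))) *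
      ∏ i : Fin k, b (v (σ (Fin.natAdd 1 (evenIdx i)))) (v (σ (Fin.natAdd 1 (oddIdx i))))) := by
  have : linAlt a = MultilinearMap.alternatization
      (MultilinearMap.ofSubsingleton ℝ V ℝ (0 : Fin 1) a) := by
    ext v
    simp [linAlt, MultilinearMap.alternatization_apply]
  rw [this, wedgePower_bilinAlt, wedgeProduct_alternatization, MultilinearMap.alternatization_apply]
  refine Finset.sum_congr rfl fun σ _ => ?_
  rw [MultilinearMap.domDomCongr_apply, Units.smul_def, zsmul_eq_mul]
  simp only [MultilinearMap.domDomCongr_apply, LinearMap.compMultilinearMap_apply,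
    MultilinearMap.domCoprod_apply, LinearMap.mul'_apply, bilinPower_apply]
  rfl

/-- The even permutation of `Fin (2 * k)` that exchanges two pairs `(2 * i, 2 * i + 1)` and
`(2 * j, 2 * j + 1)`. -/
def pairSwap {k : ℕ} (i j : Fin k) : Equiv.Perm (Fin (2 * k)) :=
  Equiv.swap (evenIdx i) (evenIdx j) * Equiv.swap (oddIdx i) (oddIdx j)

theorem sign_pairSwap {k : ℕ} (i j : Fin k) : Equiv.Perm.sign (pairSwap i j) = 1 := by
  rw [pairSwap, Equiv.Perm.sign_mul, Equiv.Perm.sign_swap', Equiv.Perm.sign_swap']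
  by_cases h : i = j
  · simp [h]
  · rw [if_neg (evenIdx_injective.ne h), if_neg (oddIdx_injective.ne h)]
    norm_num

theorem pairSwap_evenIdx {k : ℕ} (i j l : Fin k) :
    pairSwap i j (evenIdx l) = evenIdx (Equiv.swap i j l) := by
  rw [pairSwap, Equiv.Perm.mul_apply, Equiv.swap_apply_of_ne_of_ne (evenIdx_ne_oddIdx _ _)
    (evenIdx_ne_oddIdx _ _), evenIdx_injective.swap_apply]

theorem pairSwap_oddIdx {k : ℕ} (i j l : Fin k) :
    pairSwap i j (oddIdx l) = oddIdx (Equiv.swap i j l) := by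
  rw [pairSwap, Equiv.Perm.mul_apply, oddIdx_injective.swap_apply, Equiv.swap_apply_of_ne_of_ne
    (evenIdx_ne_oddIdx _ _).symm (evenIdx_ne_oddIdx _ _).symm]

theorem wedgePower_interior (a : V →ₗ[ℝ] ℝ) (b : V →ₗ[ℝ] V →ₗ[ℝ] ℝ) {X : V}
    (hX : ∀ y, b X y = a y) (hX' : ∀ x, b x X = 0) (k : ℕ) (u : Fin (2 * (k + 1)) → V)
    (hu : u 0 = X) :
    wedgePower (bilinAlt b) (k + 1) u = (k + 1) *
      wedgeProduct (linAlt a) (wedgePower (bilinAlt b) k)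
        (fun j => u ⟨j + 1, by omega⟩) := by
  set F : Equiv.Perm (Fin (2 * (k + 1))) → ℝ := fun σ => (Equiv.Perm.sign σ : ℝ) *
      ∏ i : Fin (k + 1), b (u (σ (evenIdx i))) (u (σ (oddIdx i))) with hF
  have hsplit : ∀ σ, F σ = ∑ i : Fin (k + 1), if σ (evenIdx i) = 0 then F σ else 0 := by
    intro σ
    obtain ⟨j, hj⟩ := σ.surjective 0
    rcases Nat.even_or_odd' (j : ℕ) with ⟨c, hc | hc⟩
    · rw [Finset.sum_eq_single (⟨c, by omega⟩ : Fin (k + 1))]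
      · have : evenIdx (⟨c, by omega⟩ : Fin (k + 1)) = j := Fin.ext hc.symm
        simp [this, hj]
      · intro i _ hi
        rw [if_neg]
        intro h
        exact hi (evenIdx_injective ((σ.injective (h.trans hj.symm)).trans (Fin.ext hc)))
      · simp
    · have h0 : F σ = 0 := by
        simp only [hF]
        rw [Finset.prod_eq_zero (Finset.mem_univ (⟨c, by omega⟩ : Fin (k + 1))), mul_zero]
        have : oddIdx (⟨c, by omega⟩ : Fin (k + 1)) = j := Fin.ext hc.symm
        simp [this, hj, hu, hX']
      simp [h0]
  have hsym : ∀ i : Fin (k + 1), ∑ σ, (if σ (evenIdx i) = 0 then F σ else 0) =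
      ∑ σ, if σ 0 = 0 then F σ else 0 := by
    intro i
    refine Fintype.sum_equiv (Equiv.mulRight (pairSwap 0 i)).symm _ _ fun σ => ?_
    obtain ⟨σ, rfl⟩ := (Equiv.mulRight (pairSwap 0 i)).surjective σ
    have h1 : F (σ * pairSwap 0 i) = F σ := by
      simp only [hF, Equiv.Perm.sign_mul, sign_pairSwap, mul_one, Equiv.Perm.mul_apply,
        pairSwap_evenIdx, pairSwap_oddIdx]
      congr 1
      exact Fintype.prod_equiv (Equiv.swap 0 i) _ _ fun j => rfl
    have h2 : pairSwap 0 i (evenIdx i) = 0 := by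
      rw [pairSwap_evenIdx, Equiv.swap_apply_right]
      rfl
    rw [Equiv.symm_apply_apply, Equiv.coe_mulRight, h1, Equiv.Perm.mul_apply, h2]
  rw [wedgePower_apply, linAlt_wedge_apply]
  change ∑ σ, F σ = _
  calc ∑ σ, F σ = ∑ σ, ∑ i : Fin (k + 1), (if σ (evenIdx i) = 0 then F σ else 0) :=
        Finset.sum_congr rfl fun σ _ => hsplit σ
    _ = (k + 1) * ∑ σ, if σ 0 = 0 then F σ else 0 := by
        rw [Finset.sum_comm, Finset.sum_congr rfl fun i _ => hsym i, Finset.sum_const,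
          Finset.card_univ, Fintype.card_fin, nsmul_eq_mul, Nat.cast_add_one]
    _ = _ := by
        congr 1
        refine (Equiv.sum_comp (Equiv.Perm.decomposeFin (n := 2 * k + 1)).symm
          fun σ => if σ 0 = 0 then F σ else 0).symm.trans ?_
        rw [Fintype.sum_prod_type]
        refine (Finset.sum_eq_single 0 (fun p _ hp => Finset.sum_eq_zero fun e _ =>
          if_neg ?_) (by simp)).trans ?_
        · rwa [Equiv.Perm.decomposeFin_symm_apply_zero]
        refine Fintype.sum_equiv (finCongr (Nat.add_comm (2 * k) 1)).permCongr _ _ fun e => ?_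
        have hval : ∀ (j : Fin (2 * k + 1)) (l : Fin (1 + 2 * k)), (j : ℕ) = l →
            u (Equiv.Perm.decomposeFin.symm (0, e) j.succ) =
              u ⟨((finCongr (Nat.add_comm (2 * k) 1)).permCongr e l : ℕ) + 1, by omega⟩ := by
          intro j l h
          have h' : (finCongr (Nat.add_comm (2 * k) 1)).symm l = j := Fin.ext h.symm
          rw [Equiv.Perm.decomposeFin_symm_apply_succ, Equiv.swap_self, ← h']
          rfl
        rw [if_pos (Equiv.Perm.decomposeFin_symm_apply_zero _ _), Equiv.Perm.sign_permCongr]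
        simp only [hF, Equiv.Perm.decomposeFin.symm_sign, if_true, one_mul]
        congr 1
        rw [Fin.prod_univ_succ]
        congr 1
        · have h0 : Equiv.Perm.decomposeFin.symm (0, e) (evenIdx (0 : Fin (k + 1))) = 0 :=
            Equiv.Perm.decomposeFin_symm_apply_zero _ _
          rw [h0, hu, hX]
          exact congrArg a (hval 0 (Fin.castAdd (2 * k) 0) rfl)
        · refine Finset.prod_congr rfl fun i _ => ?_
          exact congrArg₂ (fun x y => b x y)
            (hval ⟨2 * i + 1, by omega⟩ (Fin.natAdd 1 (evenIdx i)) (Nat.add_comm _ _))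
            (hval ⟨2 * i + 2, by omega⟩ (Fin.natAdd 1 (oddIdx i)) (Nat.add_comm (2 * i + 1) 1))

theorem linAlt_wedge_eq_zero (a : V →ₗ[ℝ] ℝ) (b : V →ₗ[ℝ] V →ₗ[ℝ] ℝ) {X : V}
    (hX : ∀ y, b X y = a y) (hX' : ∀ x, b x X = 0) (k : ℕ) (v : Fin (1 + 2 * k) → V)
    (j : Fin (1 + 2 * k)) (hj : v j = X) :
    wedgeProduct (linAlt a) (wedgePower (bilinAlt b) k) v = 0 := by
  let u : Fin (2 * (k + 1)) → V := fun i =>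
    if h : (i : ℕ) = 0 then X else v ⟨i - 1, by omega⟩
  have h := wedgePower_interior a b hX hX' k u rfl
  rw [AlternatingMap.map_eq_zero_of_eq (i := 0) (j := ⟨j + 1, by omega⟩)] at h
  · have hv : (fun j : Fin (1 + 2 * k) => u ⟨j + 1, by omega⟩) = v := by
      ext i; simp [u]
    rw [hv] at h
    exact (mul_eq_zero.1 h.symm).resolve_left (by positivity)
  · exact ((dif_neg (Nat.succ_ne_zero _)).trans hj).symm
  · exact fun h0 => Nat.succ_ne_zero _ (congrArg Fin.val h0).symm

/-- A vector whose insertion annihilates an alternating form may be added to its arguments. -/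
theorem AlternatingMap.map_add_smul_of_annihilates {ι : Type*} [Fintype ι] [DecidableEq ι]
    (f : V [⋀^ι]→ₗ[ℝ] ℝ) {X : V} (hf : ∀ v j, v j = X → f v = 0) (v : ι → V) (c : ι → ℝ) :
    f (fun i => v i + c i • X) = f v := by
  have h := f.toMultilinearMap.map_add_univ v (fun i => c i • X)
  refine h.trans ((Finset.sum_eq_single Finset.univ (fun s _ hs => ?_) (by simp)).trans (by simp))
  obtain ⟨i, hi⟩ : ∃ i, i ∉ s := by
    by_contra! hcon
    exact hs (Finset.eq_univ_of_forall hcon)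
  have hp : s.piecewise v (fun i => c i • X) =
      Function.update (s.piecewise v (fun i => c i • X)) i (c i • X) := by
    rw [eq_comm, Function.update_eq_self_iff]
    simp [hi]
  rw [hp, MultilinearMap.map_update_smul]
  rw [smul_eq_zero]
  exact Or.inr (hf _ i (Function.update_self ..))

theorem linAlt_wedge_map_of_scaling {V' : Type*} [AddCommGroup V'] [Module ℝ V'] {a : V →ₗ[ℝ] ℝ}
    {b : V →ₗ[ℝ] V →ₗ[ℝ] ℝ} {a' : V' →ₗ[ℝ] ℝ} {b' : V' →ₗ[ℝ] V' →ₗ[ℝ] ℝ} {L : V → V'} {c : ℝ}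
    (ha : ∀ x, a' (L x) = c * a x) (hb : ∀ x y, b' (L x) (L y) = c * b x y) (k : ℕ)
    (v : Fin (1 + 2 * k) → V) :
    wedgeProduct (linAlt a') (wedgePower (bilinAlt b') k) (fun i => L (v i)) =
      c ^ (k + 1) * wedgeProduct (linAlt a) (wedgePower (bilinAlt b) k) v := by
  simp only [linAlt_wedge_apply, ha, hb, Finset.prod_mul_distrib, Finset.prod_const,
    Finset.card_univ, Fintype.card_fin, Finset.mul_sum]
  refine Finset.sum_congr rfl fun σ _ => by ring

/-- Two alternating forms of top degree agree if they agree after insertion of a nonzero vector. -/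
theorem AlternatingMap.ext_of_insert [FiniteDimensional ℝ V] {m : ℕ}
    (hm : Module.finrank ℝ V = m) {f g : V [⋀^Fin m]→ₗ[ℝ] ℝ} {X : V} (hX : X ≠ 0) (i : Fin m)
    (h : ∀ v, v i = X → f v = g v) : f = g := by
  have hli : LinearIndepOn ℝ id {X} := LinearIndepOn.singleton hX
  let e := Module.Basis.extend hli
  have : Fintype (hli.extend (subset_univ _)) := FiniteDimensional.fintypeBasisIndex e
  have hcard : Fintype.card (hli.extend (subset_univ _)) = Fintype.card (Fin m) := by
    rw [← Module.finrank_eq_card_basis e, hm, Fintype.card_fin]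
  refine e.ext_alternating fun v hv => ?_
  obtain ⟨j, hj⟩ := ((Fintype.bijective_iff_injective_and_card v).2 ⟨hv, hcard.symm⟩).2
    ⟨X, hli.subset_extend _ rfl⟩
  have hs := h ((fun i => e (v i)) ∘ Equiv.swap i j) (by
    rw [Function.comp_apply, Equiv.swap_apply_left, hj, Module.Basis.extend_apply_self])
  rw [AlternatingMap.map_perm, AlternatingMap.map_perm] at hs
  exact smul_left_cancel _ hs

end ExteriorAlgebra

/-- The exterior derivative of a 1-form with linear coefficients. -/
theorem extDerivWithin_linear_form {G : Type*} [NormedAddCommGroup G] [NormedSpace ℝ G]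
    (L : G →L[ℝ] G →L[ℝ] ℝ) {s : Set G} {y : G} (hs : UniqueDiffWithinAt ℝ s y) (v : Fin 2 → G) :
    extDerivWithin (fun y => ContinuousAlternatingMap.ofSubsingleton ℝ G ℝ (0 : Fin 1) (L y)) s y v =
      L (v 0) (v 1) - L (v 1) (v 0) := by
  have hd : DifferentiableWithinAt ℝ
      (fun y => ContinuousAlternatingMap.ofSubsingleton ℝ G ℝ (0 : Fin 1) (L y)) s y :=
    (ContinuousAlternatingMap.ofSubsingletonLIE (𝕜 := ℝ) (E := G) (F := ℝ)
      (0 : Fin 1)).differentiable.differentiableAt.comp_differentiableWithinAt _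
        L.differentiableAt.differentiableWithinAt
  have hw : ∀ w u : G, fderivWithin ℝ (fun y => L y w) s y u = L u w := by
    intro w u
    have h : HasFDerivAt (fun y => L y w) ((ContinuousLinearMap.apply ℝ ℝ w).comp L) y :=
      ((ContinuousLinearMap.apply ℝ ℝ w).comp L).hasFDerivAt
    rw [h.hasFDerivWithinAt.fderivWithin hs]
    rfl
  rw [extDerivWithin_apply hd hs, Fin.sum_univ_two]
  refine (congrArg₂ (· + ·) (congrArg _ (hw (v 1) (v 0))) (congrArg _ (hw (v 0) (v 1)))).trans ?_
  simp [sub_eq_add_neg]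

/-- The canonical 1-form of `E × E*` as a function of the base point. -/
def canonicalCLM (E : Type*) [NormedAddCommGroup E] [NormedSpace ℝ E] :
    (E × (E →L[ℝ] ℝ)) →L[ℝ] (E × (E →L[ℝ] ℝ)) →L[ℝ] ℝ :=
  (((ContinuousLinearMap.compL ℝ (E × (E →L[ℝ] ℝ)) E ℝ).flip
    (ContinuousLinearMap.fst ℝ E (E →L[ℝ] ℝ)))).comp (ContinuousLinearMap.snd ℝ E (E →L[ℝ] ℝ))

section CotangentCoordinates
open Filter Topology

variable {E : Type*} [NormedAddCommGroup E] [NormedSpace ℝ E] {H : Type*} [TopologicalSpace H]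
  {I : ModelWithCorners ℝ E H} {M : Type*} [TopologicalSpace M] [ChartedSpace H M]
  [IsManifold I ∞ M]

/-- The fibre coordinate of `q` in the trivialization of the cotangent bundle around `x`. -/
def fiberCoord (x : M) (q : CotangentBundle I M) : E →L[ℝ] ℝ :=
  (trivializationAt (E →L[ℝ] ℝ) (fun x : M => TangentSpace I x →L[ℝ] ℝ) x q).2

theorem fiberCoord_eq (x : M) (q : CotangentBundle I M) : fiberCoord x q =
    q.2.comp ((trivializationAt E (TangentSpace I) x).symmL ℝ q.1) := by
  rw [fiberCoord, hom_trivializationAt_apply]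
  simp only [ContinuousLinearMap.inCoordinates]
  ext v
  simp

theorem fiberCoord_self (p : CotangentBundle I M) : fiberCoord p.1 p = p.2 := by
  rw [fiberCoord_eq]
  ext v
  rw [TangentBundle.symmL_trivializationAt_eq_core (mem_chart_source H p.1)]
  exact congrArg p.2 (tangentCoordChange_self (I := I) (mem_extChartAt_source p.1))

theorem extChartAt_cotangent (p q : CotangentBundle I M) :
    extChartAt (cotangentModel I) p q = (extChartAt I p.1 q.1, fiberCoord p.1 q) := by
  rw [FiberBundle.extChartAt]
  rfl

theorem hasMFDerivAt_cotangent {F' : Type*} [NormedAddCommGroup F'] [NormedSpace ℝ F'] {G' : Type*}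
    [TopologicalSpace G'] {J' : ModelWithCorners ℝ F' G'} {N : Type*} [TopologicalSpace N]
    [ChartedSpace G' N] {f : N → CotangentBundle I M} {z : N} {D₁ : TangentSpace J' z →L[ℝ] E}
    {D₂ : TangentSpace J' z →L[ℝ] (E →L[ℝ] ℝ)} (hf : ContinuousAt f z)
    (h₁ : HasMFDerivAt J' I (fun y => (f y).1) z D₁)
    (h₂ : HasMFDerivAt J' 𝓘(ℝ, E →L[ℝ] ℝ) (fun y => fiberCoord (f z).1 (f y)) z D₂) :
    HasMFDerivAt J' (cotangentModel I) f z (D₁.prod D₂) := by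
  refine ⟨hf, ?_⟩
  have := h₁.2.prodMk h₂.2
  refine this.congr_of_eventuallyEq (Eventually.of_forall fun y => ?_) ?_
  · simp only [writtenInExtChartAt, Function.comp_apply, extChartAt_cotangent]
    rfl
  · simp only [writtenInExtChartAt, Function.comp_apply, extChartAt_cotangent]
    rfl

theorem eventually_extChartAt_symm (p : CotangentBundle I M) :
    ∀ᶠ y in 𝓝[range (cotangentModel I)] (extChartAt (cotangentModel I) p p),
      extChartAt (cotangentModel I) p ((extChartAt (cotangentModel I) p).symm y) = y :=
  Filter.mem_of_superset (extChartAt_target_mem_nhdsWithin p) fun _ hy => (extChartAt _ p).right_inv hy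

theorem hasMFDerivAt_proj (p : CotangentBundle I M) :
    HasMFDerivAt (cotangentModel I) I (TotalSpace.proj : CotangentBundle I M → M) p
      (ContinuousLinearMap.fst ℝ E (E →L[ℝ] ℝ)) := by
  refine ⟨(FiberBundle.continuous_proj _ _).continuousAt, ?_⟩
  refine hasFDerivWithinAt_fst.congr_of_eventuallyEq ?_ ?_
  · filter_upwards [eventually_extChartAt_symm p] with y hy
    rw [extChartAt_cotangent] at hy
    exact congrArg Prod.fst hy
  · rw [writtenInExtChartAt, Function.comp_apply, Function.comp_apply, extChartAt_to_inv,
      extChartAt_cotangent]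

theorem hasMFDerivAt_fiberCoord (p : CotangentBundle I M) :
    HasMFDerivAt (cotangentModel I) 𝓘(ℝ, E →L[ℝ] ℝ) (fiberCoord (I := I) p.1) p
      (ContinuousLinearMap.snd ℝ E (E →L[ℝ] ℝ)) := by
  refine ⟨?_, ?_⟩
  · exact (continuousAt_snd.comp (continuousAt_extChartAt (I := cotangentModel I) p)).congr
      (Eventually.of_forall fun q => by rw [Function.comp_apply, extChartAt_cotangent])
  refine hasFDerivWithinAt_snd.congr_of_eventuallyEq ?_ ?_
  · filter_upwards [eventually_extChartAt_symm p] with y hy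
    rw [extChartAt_cotangent] at hy
    exact congrArg Prod.snd hy
  · rw [writtenInExtChartAt, Function.comp_apply, Function.comp_apply, extChartAt_to_inv,
      extChartAt_cotangent]
    rfl

theorem canonicalForm_toAlternatingMap (p : CotangentBundle I M) :
    (canonicalForm p).toAlternatingMap =
      linAlt (V := TangentSpace (cotangentModel I) p)
        ((p.2.comp (ContinuousLinearMap.fst ℝ E (E →L[ℝ] ℝ)) : E × (E →L[ℝ] ℝ) →L[ℝ] ℝ) :
          E × (E →L[ℝ] ℝ) →ₗ[ℝ] ℝ) := by
  ext v
  rw [canonicalForm, (hasMFDerivAt_proj p).mfderiv]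
  rfl

theorem mem_extChartAt_cotangent_source {p q : CotangentBundle I M}
    (hq : q ∈ (extChartAt (cotangentModel I) p).source) : q.1 ∈ (chartAt H p.1).source := by
  rw [FiberBundle.extChartAt] at hq
  have := hq.1
  simpa using this

theorem proj_extChartAt_symm {p : CotangentBundle I M} {y : E × (E →L[ℝ] ℝ)}
    (hy : y ∈ (extChartAt (cotangentModel I) p).target) :
    ((extChartAt (cotangentModel I) p).symm y).1 = (extChartAt I p.1).symm y.1 := by
  have h := (extChartAt (cotangentModel I) p).right_inv hy
  rw [extChartAt_cotangent] at h
  refine ((extChartAt I p.1).left_inv ((extChartAt_source I p.1).symm ▸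
    mem_extChartAt_cotangent_source ((extChartAt (cotangentModel I) p).map_target hy))).symm.trans ?_
  exact congrArg (extChartAt I p.1).symm (congrArg Prod.fst h)

/-- The canonical form read in a chart of the cotangent bundle. -/
theorem canonicalForm_inChart (p : CotangentBundle I M) {y : E × (E →L[ℝ] ℝ)}
    (hy : y ∈ (extChartAt (cotangentModel I) p).target) :
    (canonicalForm ((extChartAt (cotangentModel I) p).symm y)).compContinuousLinearMap
      (mfderivWithin 𝓘(ℝ, E × (E →L[ℝ] ℝ)) (cotangentModel I) (extChartAt (cotangentModel I) p).symm
        (range (cotangentModel I)) y) =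
    ContinuousAlternatingMap.ofSubsingleton ℝ (E × (E →L[ℝ] ℝ)) ℝ (0 : Fin 1)
      (y.2.comp (ContinuousLinearMap.fst ℝ E (E →L[ℝ] ℝ))) := by
  have : IsManifold I 1 M := .of_le (n := ∞) (by simp)
  have : IsManifold (cotangentModel I) 1 (CotangentBundle I M) := .of_le (n := ∞) (by simp)
  set q := (extChartAt (cotangentModel I) p).symm y with hq
  have hqs := mem_extChartAt_cotangent_source ((extChartAt (cotangentModel I) p).map_target hy)
  have hyq := (extChartAt (cotangentModel I) p).right_inv hy
  rw [← hq, extChartAt_cotangent] at hyq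
  have hyr : y ∈ range (cotangentModel I) := extChartAt_target_subset_range p hy
  have hy1 : extChartAt I p.1 q.1 = y.1 := congrArg Prod.fst hyq
  have hy2 : fiberCoord p.1 q = y.2 := congrArg Prod.snd hyq
  have hU : UniqueMDiffWithinAt 𝓘(ℝ, E × (E →L[ℝ] ℝ)) (range (cotangentModel I)) y :=
    (cotangentModel I).uniqueMDiffOn y hyr
  have hy1t : y.1 ∈ (extChartAt I p.1).target := by
    rw [← hy1]
    exact (extChartAt I p.1).map_source ((extChartAt_source I p.1).symm ▸ hqs)
  have h1 : HasMFDerivWithinAt 𝓘(ℝ, E × (E →L[ℝ] ℝ)) I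
      ((TotalSpace.proj : CotangentBundle I M → M) ∘ (extChartAt (cotangentModel I) p).symm)
      (range (cotangentModel I)) y
      ((mfderivWithin 𝓘(ℝ, E) I (extChartAt I p.1).symm (range I) y.1).comp
        (ContinuousLinearMap.fst ℝ E (E →L[ℝ] ℝ))) := by
    have h := HasMFDerivWithinAt.comp y
      (mdifferentiableWithinAt_extChartAt_symm hy1t).hasMFDerivWithinAt
      (hasFDerivWithinAt_fst (𝕜 := ℝ) (s := range (cotangentModel I)) (p := y)).hasMFDerivWithinAt
      (by rintro _ ⟨z, rfl⟩; exact ⟨z.1, rfl⟩)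
    refine h.congr_of_eventuallyEq ?_ (proj_extChartAt_symm hy)
    filter_upwards [extChartAt_target_mem_nhdsWithin_of_mem hy] with z hz
    exact proj_extChartAt_symm hz
  have h2 := (hasMFDerivAt_proj q).comp_hasMFDerivWithinAt y
    (mdifferentiableWithinAt_extChartAt_symm hy).hasMFDerivWithinAt
  have h3 := hU.eq h2 h1
  ext v
  have h4 := congrArg (fun L => L (v 0)) h3
  rw [canonicalForm, (hasMFDerivAt_proj q).mfderiv]
  change q.2 _ = y.2 (v 0).1
  refine (congrArg q.2 h4).trans ?_
  rw [← hy2, fiberCoord_eq, TangentBundle.symmL_trivializationAt hqs, hy1]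
  rfl

theorem symplecticForm_apply (p : CotangentBundle I M) (v : Fin 2 → E × (E →L[ℝ] ℝ)) :
    symplecticForm p v = (v 0).2 (v 1).1 - (v 1).2 (v 0).1 := by
  have : IsManifold (cotangentModel I) 1 (CotangentBundle I M) := .of_le (n := ∞) (by simp)
  have hU := (cotangentModel I).uniqueDiffOn _ (extChartAt_target_subset_range p
    (mem_extChartAt_target p))
  have h1 : symplecticForm p v = extDerivWithin (fun y =>
      ContinuousAlternatingMap.ofSubsingleton ℝ (E × (E →L[ℝ] ℝ)) ℝ (0 : Fin 1) (canonicalCLM E y))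
      (range (cotangentModel I))
      (extChartAt (cotangentModel I) p p) v := by
    rw [symplecticForm, manifoldExtDeriv, mfderiv_extChartAt_self]
    refine congrArg (fun (η : (E × (E →L[ℝ] ℝ)) [⋀^Fin 2]→L[ℝ] ℝ) => η v)
      (?_ : extDerivWithin _ (range (cotangentModel I)) _ = _)
    refine Filter.EventuallyEq.extDerivWithin_eq_of_mem ?_
      (extChartAt_target_subset_range p (mem_extChartAt_target p))
    filter_upwards [extChartAt_target_mem_nhdsWithin p] with y hy
    exact canonicalForm_inChart p hy
  exact h1.trans (extDerivWithin_linear_form (canonicalCLM E) hU v)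

variable (E) in
/-- The bilinear form `((x, ξ), (y, η)) ↦ ξ y` on `E × E*`, whose alternatization is the standard
symplectic form. -/
def cotangentPairing : (E × (E →L[ℝ] ℝ)) →ₗ[ℝ] (E × (E →L[ℝ] ℝ)) →ₗ[ℝ] ℝ :=
  LinearMap.mk₂ ℝ (fun x y => x.2 y.1) (by simp) (by simp) (by simp) (by simp)

/-- The linear form `(x, η) ↦ ξ x` on `E × E*`. -/
def liftCovector (ξ : E →L[ℝ] ℝ) : (E × (E →L[ℝ] ℝ)) →ₗ[ℝ] ℝ :=
  (ξ.comp (ContinuousLinearMap.fst ℝ E (E →L[ℝ] ℝ)) : E × (E →L[ℝ] ℝ) →L[ℝ] ℝ)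

theorem symplecticForm_toAlternatingMap (p : CotangentBundle I M) :
    (symplecticForm p).toAlternatingMap =
      bilinAlt (V := TangentSpace (cotangentModel I) p) (cotangentPairing E) := by
  refine AlternatingMap.ext fun v => ?_
  exact (symplecticForm_apply p v).trans (bilinAlt_apply (cotangentPairing E) v).symm

theorem omegaForm_eq (n : ℕ) (p : CotangentBundle I M)
    (v : Fin (1 + 2 * (n - 1)) → TangentSpace (cotangentModel I) p) :
    omegaForm n p v = (n.factorial : ℝ)⁻¹ *
      wedgeProduct (V := E × (E →L[ℝ] ℝ)) (linAlt (liftCovector p.2))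
        (wedgePower (bilinAlt (cotangentPairing E)) (n - 1)) v := by
  rw [omegaForm, symplecticForm_toAlternatingMap, canonicalForm_toAlternatingMap]
  rfl

theorem liouvilleForm_eq (n : ℕ) (p : CotangentBundle I M)
    (v : Fin (2 * n) → TangentSpace (cotangentModel I) p) :
    liouvilleForm n p v = (n.factorial : ℝ)⁻¹ *
      wedgePower (V := E × (E →L[ℝ] ℝ)) (bilinAlt (cotangentPairing E)) n v := by
  rw [liouvilleForm, symplecticForm_toAlternatingMap]
  rfl

/-! ### Fibrewise scaling -/

theorem fiberCoord_scaleCovector (x : M) (t : ℝ) (q : CotangentBundle I M) :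
    fiberCoord x (scaleCovector t q) = t • fiberCoord x q := by
  rw [fiberCoord_eq, fiberCoord_eq, scaleCovector]
  rfl

theorem continuousAt_scaleCovector {N : Type*} [TopologicalSpace N] {s : N → ℝ}
    {f : N → CotangentBundle I M} {z : N} (hs : ContinuousAt s z) (hf : ContinuousAt f z) :
    ContinuousAt (fun y => scaleCovector (s y) (f y)) z := by
  rw [FiberBundle.continuousAt_totalSpace] at hf ⊢
  refine ⟨hf.1, ?_⟩
  refine (hs.smul hf.2).congr (Eventually.of_forall fun y => ?_)
  exact (fiberCoord_scaleCovector _ _ _).symm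

theorem contMDiffAt_scaleCovector {F' : Type*} [NormedAddCommGroup F'] [NormedSpace ℝ F'] {G' : Type*}
    [TopologicalSpace G'] {J' : ModelWithCorners ℝ F' G'} {N : Type*} [TopologicalSpace N]
    [ChartedSpace G' N] {s : N → ℝ} {f : N → CotangentBundle I M} {z : N} {m : ℕ∞ω}
    (hs : ContMDiffAt J' 𝓘(ℝ, ℝ) m s z) (hf : ContMDiffAt J' (cotangentModel I) m f z) :
    ContMDiffAt J' (cotangentModel I) m (fun y => scaleCovector (s y) (f y)) z := by
  rw [Bundle.contMDiffAt_totalSpace] at hf ⊢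
  refine ⟨hf.1, ?_⟩
  refine (hs.smul hf.2).congr_of_eventuallyEq (Eventually.of_forall fun y => ?_)
  exact fiberCoord_scaleCovector _ _ _

/-- The Euler vector field at `p`. -/
theorem hasMFDerivAt_scaleCovector_curve (p : CotangentBundle I M) :
    HasMFDerivAt 𝓘(ℝ, ℝ) (cotangentModel I) (fun t : ℝ => scaleCovector t p) 1
      ((0 : ℝ →L[ℝ] E).prod (ContinuousLinearMap.toSpanSingleton ℝ (p.2 : E →L[ℝ] ℝ))) := by
  refine hasMFDerivAt_cotangent ?_ (hasMFDerivAt_const _ _) ?_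
  · exact continuousAt_scaleCovector continuousAt_id continuousAt_const
  · have h : HasFDerivAt (fun t : ℝ => t • (p.2 : E →L[ℝ] ℝ))
        (ContinuousLinearMap.toSpanSingleton ℝ (p.2 : E →L[ℝ] ℝ)) 1 :=
      (ContinuousLinearMap.toSpanSingleton ℝ (p.2 : E →L[ℝ] ℝ)).hasFDerivAt
    refine h.hasMFDerivAt.congr_of_eventuallyEq (Eventually.of_forall fun t => ?_)
    refine (fiberCoord_scaleCovector _ _ _).trans ?_
    exact congrArg (t • ·) (fiberCoord_self p)

theorem hasMFDerivAt_scaleCovector {s : CotangentBundle I M → ℝ} {p : CotangentBundle I M}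
    {ℓ : E × (E →L[ℝ] ℝ) →L[ℝ] ℝ} (hs : HasMFDerivAt (cotangentModel I) 𝓘(ℝ, ℝ) s p ℓ) :
    HasMFDerivAt (cotangentModel I) (cotangentModel I) (fun q => scaleCovector (s q) q) p
      ((ContinuousLinearMap.fst ℝ E (E →L[ℝ] ℝ)).prod
        (s p • ContinuousLinearMap.snd ℝ E (E →L[ℝ] ℝ) + ℓ.smulRight (show E →L[ℝ] ℝ from p.2))) := by
  refine hasMFDerivAt_cotangent (continuousAt_scaleCovector hs.1 continuousAt_id)
    (hasMFDerivAt_proj p) ?_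
  have hc := hasMFDerivAt_fiberCoord p
  have h := hs.2.smul hc.2
  have hmf : HasMFDerivAt (cotangentModel I) 𝓘(ℝ, E →L[ℝ] ℝ) (fun q => s q • fiberCoord p.1 q) p
      (s p • ContinuousLinearMap.snd ℝ E (E →L[ℝ] ℝ) + ℓ.smulRight (show E →L[ℝ] ℝ from p.2)) := by
    refine ⟨hs.1.smul hc.1, ?_⟩
    refine HasFDerivWithinAt.congr_fderiv h ?_
    simp only [writtenInExtChartAt, Function.comp_apply, extChartAt_to_inv,
      extChartAt_model_space_eq_id, PartialEquiv.refl_coe, id_eq, fiberCoord_self]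
    rfl
  refine hmf.congr_of_eventuallyEq (Eventually.of_forall fun q => ?_)
  exact fiberCoord_scaleCovector _ _ _

end CotangentCoordinates

section Transport

/-- Weighting a measure with a possibly non-measurable density. -/
theorem setLIntegral_mul_le_lintegral_withDensity {X : Type*} [MeasurableSpace X] (μ : Measure X)
    {w f : X → ℝ≥0∞} (hw : AEMeasurable w μ) (hw0 : ∀ᵐ x ∂μ, w x ≠ 0) (hwt : ∀ᵐ x ∂μ, w x ≠ ⊤) :
    ∫⁻ x, w x * f x ∂μ ≤ ∫⁻ x, w x ∂(μ.withDensity f) := by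
  obtain ⟨g, hg, hgf, hint⟩ := exists_measurable_le_lintegral_eq μ fun x => w x * f x
  have hgw : AEMeasurable (fun x => g x / w x) μ := hg.aemeasurable.div hw
  calc ∫⁻ x, w x * f x ∂μ = ∫⁻ x, g x ∂μ := hint
    _ = ∫⁻ x, ((fun x => g x / w x) * w) x ∂μ := by
        refine lintegral_congr_ae ?_
        filter_upwards [hw0, hwt] with x h0 ht
        exact (ENNReal.div_mul_cancel h0 ht).symm
    _ = ∫⁻ x, w x ∂(μ.withDensity fun x => g x / w x) :=
        (lintegral_withDensity_eq_lintegral_mul₀' hgw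
          (hw.mono_ac (withDensity_absolutelyContinuous _ _))).symm
    _ ≤ ∫⁻ x, w x ∂(μ.withDensity f) := by
        refine lintegral_mono' ?_ le_rfl
        refine withDensity_mono ?_
        filter_upwards [hw0, hwt] with x h0 ht
        exact ENNReal.div_le_of_le_mul' (hgf x)

variable {F : Type*} [NormedAddCommGroup F] [NormedSpace ℝ F] {G : Type*} [TopologicalSpace G]
  {J : ModelWithCorners ℝ F G} {N : Type*} [TopologicalSpace N] [ChartedSpace G N]

theorem IsLocalParametrization.mono {S S' : Set N} {m : ℕ} {D : Set (Fin m → ℝ)}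
    {σ : (Fin m → ℝ) → N} (h : IsLocalParametrization J S D σ) (hS : S ⊆ S') :
    IsLocalParametrization J S' D σ :=
  ⟨h.isOpen, h.smooth, h.injOn, h.mapsTo.mono_right hS, h.immersive⟩

theorem IsLocalParametrization.inter_preimage {S O : Set N} {m : ℕ} {D : Set (Fin m → ℝ)}
    {σ : (Fin m → ℝ) → N} (h : IsLocalParametrization J S D σ) (hO : IsOpen O) :
    IsLocalParametrization J (S ∩ O) (D ∩ σ ⁻¹' O) σ where
  isOpen := h.smooth.continuousOn.isOpen_inter_preimage h.isOpen hO
  smooth := h.smooth.mono inter_subset_left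
  injOn := h.injOn.mono inter_subset_left
  mapsTo := fun _ hu => ⟨h.mapsTo hu.1, hu.2⟩
  immersive := fun u hu => h.immersive u hu.1

theorem IsLocalParametrization.mdifferentiableAt {S : Set N} {m : ℕ} {D : Set (Fin m → ℝ)}
    {σ : (Fin m → ℝ) → N} (h : IsLocalParametrization J S D σ) {u : Fin m → ℝ} (hu : u ∈ D) :
    MDifferentiableAt 𝓘(ℝ, Fin m → ℝ) J σ u :=
  (h.smooth.contMDiffAt (h.isOpen.mem_nhds hu)).mdifferentiableAt (by simp)

theorem IsLocalParametrization.comp {S S' O O' : Set N} (hO : IsOpen O) (hO' : IsOpen O')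
    (hSO : S ⊆ O) (hSO' : S' ⊆ O') {ψ θ : N → N} (hψ : ContMDiffOn J J ∞ ψ O)
    (hθ : ContMDiffOn J J ∞ θ O') (hmaps : MapsTo ψ S S') (hinv : ∀ p ∈ S, θ (ψ p) = p)
    {m : ℕ} {D : Set (Fin m → ℝ)} {σ : (Fin m → ℝ) → N} (h : IsLocalParametrization J S D σ) :
    IsLocalParametrization J S' D (ψ ∘ σ) where
  isOpen := h.isOpen
  smooth := hψ.comp h.smooth fun _ hu => hSO (h.mapsTo hu)
  injOn := fun u hu u' hu' he => h.injOn hu hu' <| by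
    rw [← hinv _ (h.mapsTo hu), ← hinv _ (h.mapsTo hu')]
    exact congrArg θ he
  mapsTo := hmaps.comp h.mapsTo
  immersive := fun u hu => by
    have hS := h.mapsTo hu
    have hd : MDifferentiableAt 𝓘(ℝ, Fin m → ℝ) J (ψ ∘ σ) u :=
      ((hψ.contMDiffAt (hO.mem_nhds (hSO hS))).mdifferentiableAt (by simp)).comp u
        (h.mdifferentiableAt hu)
    have hc := mfderiv_comp u ((hθ.contMDiffAt (hO'.mem_nhds (hSO' (hmaps hS)))).mdifferentiableAt
      (by simp)) hd
    have he : θ ∘ (ψ ∘ σ) =ᶠ[nhds u] σ := by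
      filter_upwards [h.isOpen.mem_nhds hu] with u' hu'
      exact hinv _ (h.mapsTo hu')
    have hi := h.immersive u hu
    rw [← he.mfderiv_eq, hc] at hi
    exact Function.Injective.of_comp hi

variable [MeasurableSpace N]

theorem le_formMeasure {S : Set N} {m : ℕ} (η : (p : N) → TangentSpace J p [⋀^Fin m]→ₗ[ℝ] ℝ)
    {D : Set (Fin m → ℝ)} {σ : (Fin m → ℝ) → N} (h : IsLocalParametrization J S D σ) :
    ((volume.restrict D).withDensity fun u => ENNReal.ofReal |pullbackCoefficient J η σ u|).map σ ≤
      formMeasure J S η :=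
  le_iSup_of_le D (le_iSup_of_le σ (le_iSup_of_le h le_rfl))

theorem formMeasure_le {S : Set N} {m : ℕ} {η : (p : N) → TangentSpace J p [⋀^Fin m]→ₗ[ℝ] ℝ}
    {ν : Measure N} (h : ∀ (D : Set (Fin m → ℝ)) (σ : (Fin m → ℝ) → N),
      IsLocalParametrization J S D σ → ((volume.restrict D).withDensity
        fun u => ENNReal.ofReal |pullbackCoefficient J η σ u|).map σ ≤ ν) :
    formMeasure J S η ≤ ν :=
  iSup_le fun D => iSup_le fun σ => iSup_le fun hσ => h D σ hσ

theorem formMeasure_mono {S S' : Set N} (hS : S ⊆ S') {m : ℕ}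
    (η : (p : N) → TangentSpace J p [⋀^Fin m]→ₗ[ℝ] ℝ) :
    formMeasure J S η ≤ formMeasure J S' η :=
  formMeasure_le fun _ _ h => le_formMeasure η (h.mono hS)

variable [BorelSpace N]

theorem IsLocalParametrization.aemeasurable {S : Set N} {m : ℕ} {D : Set (Fin m → ℝ)}
    {σ : (Fin m → ℝ) → N} (h : IsLocalParametrization J S D σ) (f : (Fin m → ℝ) → ℝ≥0∞) :
    AEMeasurable σ ((volume.restrict D).withDensity f) :=
  (h.smooth.continuousOn.aemeasurable h.isOpen.measurableSet).mono_ac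
    (withDensity_absolutelyContinuous _ _)

theorem IsLocalParametrization.map_withDensity_apply {S : Set N} {m : ℕ} {D : Set (Fin m → ℝ)}
    {σ : (Fin m → ℝ) → N} (h : IsLocalParametrization J S D σ) (f : (Fin m → ℝ) → ℝ≥0∞) {X : Set N}
    (hX : MeasurableSet X) :
    ((volume.restrict D).withDensity f).map σ X = ∫⁻ u in σ ⁻¹' X ∩ D, f u := by
  rw [Measure.map_apply_of_aemeasurable (h.aemeasurable _) hX, withDensity_apply',
    Measure.restrict_restrict' h.isOpen.measurableSet]

theorem formMeasure_compl {S : Set N} (hS : MeasurableSet S) {m : ℕ}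
    (η : (p : N) → TangentSpace J p [⋀^Fin m]→ₗ[ℝ] ℝ) : formMeasure J S η Sᶜ = 0 := by
  have h : formMeasure J S η ≤ (formMeasure J S η).restrict S := formMeasure_le fun D σ hσ => by
    refine le_trans (le_of_eq ?_) (Measure.restrict_mono le_rfl (le_formMeasure η hσ))
    refine (Measure.restrict_eq_self_of_ae_mem ?_).symm
    refine (ae_map_iff (p := (· ∈ S)) (hσ.aemeasurable _) hS).2 ?_
    exact (withDensity_absolutelyContinuous _ _).ae_le
      (ae_restrict_of_forall_mem hσ.isOpen.measurableSet hσ.mapsTo)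
  have := h Sᶜ
  rwa [Measure.restrict_apply hS.compl, compl_inter_self, measure_empty, nonpos_iff_eq_zero] at this

/-- A form measure splits along an open set. -/
theorem formMeasure_le_add {S O : Set N} (hO : IsOpen O) {m : ℕ}
    (η : (p : N) → TangentSpace J p [⋀^Fin m]→ₗ[ℝ] ℝ) :
    formMeasure J S η ≤ formMeasure J (S ∩ O) η + (formMeasure J S η).restrict Oᶜ := by
  refine formMeasure_le fun D σ hσ => Measure.le_iff.2 fun X hX => ?_
  have hOm := hO.measurableSet
  rw [← measure_inter_add_sdiff X hOm, Measure.add_apply, Measure.restrict_apply hX]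
  refine add_le_add ?_ (le_formMeasure η hσ _)
  refine le_trans ?_ (le_formMeasure η (hσ.inter_preimage hO) X)
  rw [hσ.map_withDensity_apply _ (hX.inter hOm),
    (hσ.inter_preimage hO).map_withDensity_apply _ hX, preimage_inter, inter_assoc,
    inter_comm (σ ⁻¹' O)]

/-- Transport of form measures by a local diffeomorphism `ψ` that maps the form `η` to the form
`W η'`. -/
theorem formMeasure_le_map_withDensity {S S' O O' : Set N} (hO : IsOpen O) (hO' : IsOpen O')
    (hSO : S ⊆ O) (hSO' : S' ⊆ O') {ψ θ : N → N} (hψ : ContMDiffOn J J ∞ ψ O)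
    (hθ : ContMDiffOn J J ∞ θ O') (hθm : Measurable θ) (hmaps : MapsTo ψ S S')
    (hinv : ∀ p ∈ S, θ (ψ p) = p) {W : N → ℝ≥0∞} (hW : Measurable W)
    (hW0 : ∀ p ∈ S, W (ψ p) ≠ 0) (hWt : ∀ p ∈ S, W (ψ p) ≠ ⊤) {m : ℕ}
    {η η' : (p : N) → TangentSpace J p [⋀^Fin m]→ₗ[ℝ] ℝ}
    (hη : ∀ p ∈ S, ∀ v : Fin m → TangentSpace J p, ENNReal.ofReal |η p v| =
      W (ψ p) * ENNReal.ofReal |η' (ψ p) fun i => mfderiv J J ψ p (v i)|) :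
    formMeasure J S η ≤ ((formMeasure J S' η').withDensity W).map θ := by
  refine formMeasure_le fun D σ hσ => Measure.le_iff.2 fun X hX => ?_
  have hσ' := hσ.comp hO hO' hSO hSO' hψ hθ hmaps hinv
  have hDm := hσ.isOpen.measurableSet
  set c' : (Fin m → ℝ) → ℝ≥0∞ := fun u => ENNReal.ofReal |pullbackCoefficient J η' (ψ ∘ σ) u|
  have hψσ : AEMeasurable (ψ ∘ σ) (volume.restrict D) :=
    hσ'.smooth.continuousOn.aemeasurable hDm
  calc _ = ∫⁻ u in σ ⁻¹' X, ENNReal.ofReal |pullbackCoefficient J η σ u| ∂(volume.restrict D) := by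
        rw [hσ.map_withDensity_apply _ hX, Measure.restrict_restrict' hDm]
    _ = ∫⁻ u in σ ⁻¹' X, (W ∘ ψ ∘ σ) u * c' u ∂(volume.restrict D) := by
        refine lintegral_congr_ae (ae_restrict_of_ae (ae_restrict_of_forall_mem hDm fun u hu => ?_))
        have hS := hσ.mapsTo hu
        refine (hη (σ u) hS _).trans ?_
        simp only [c', pullbackCoefficient]
        rw [mfderiv_comp u ((hψ.contMDiffAt (hO.mem_nhds (hSO hS))).mdifferentiableAt (by simp))
          (hσ.mdifferentiableAt hu)]
        rfl
    _ ≤ ∫⁻ u, (W ∘ ψ ∘ σ) u ∂(((volume.restrict D).restrict (σ ⁻¹' X)).withDensity c') := by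
        refine setLIntegral_mul_le_lintegral_withDensity _ ?_ ?_ ?_
        · exact (hW.comp_aemeasurable hψσ).mono_measure Measure.restrict_le_self
        · exact ae_restrict_of_ae (ae_restrict_of_forall_mem hDm fun u hu => hW0 _ (hσ.mapsTo hu))
        · exact ae_restrict_of_ae (ae_restrict_of_forall_mem hDm fun u hu => hWt _ (hσ.mapsTo hu))
    _ = ∫⁻ q in θ ⁻¹' X, W q ∂(((volume.restrict D).withDensity c').map (ψ ∘ σ)) := by
        have hT : (volume.restrict D).restrict (σ ⁻¹' X) =
            (volume.restrict D).restrict ((ψ ∘ σ) ⁻¹' (θ ⁻¹' X)) := by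
          rw [Measure.restrict_restrict' hDm, Measure.restrict_restrict' hDm]
          congr 1
          ext u
          refine and_congr_left fun hu => ?_
          simp only [mem_preimage, Function.comp_apply, hinv _ (hσ.mapsTo hu)]
        rw [Measure.restrict_map_of_aemeasurable (hσ'.aemeasurable _) (hθm hX),
          lintegral_map' hW.aemeasurable ((hσ'.aemeasurable _).mono_measure
            Measure.restrict_le_self), restrict_withDensity', hT]
        rfl
    _ ≤ ∫⁻ q in θ ⁻¹' X, W q ∂(formMeasure J S' η') :=
        lintegral_mono' (Measure.restrict_mono le_rfl (le_formMeasure η' hσ')) le_rfl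
    _ = _ := by rw [Measure.map_apply hθm hX, withDensity_apply _ (hθm hX)]

end Transport

section StarGeometry
open Filter Topology

variable {E : Type*} [NormedAddCommGroup E] [NormedSpace ℝ E] {H : Type*} [TopologicalSpace H]
  {I : ModelWithCorners ℝ E H} {M : Type*} [TopologicalSpace M] [ChartedSpace H M]

theorem scaleCovector_one (p : CotangentBundle I M) : scaleCovector 1 p = p := by
  rw [scaleCovector, one_smul]

theorem scaleCovector_scaleCovector (s t : ℝ) (p : CotangentBundle I M) :
    scaleCovector s (scaleCovector t p) = scaleCovector (s * t) p := by
  rw [scaleCovector, scaleCovector, scaleCovector, smul_smul]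

theorem scaleCovector_mem {t : ℝ} (ht : 0 < t) {p : CotangentBundle I M}
    (hp : p ∈ nonzeroCovectors I M) : scaleCovector t p ∈ nonzeroCovectors I M :=
  smul_ne_zero ht.ne' hp

theorem scaleCovector_of_eq_zero (t : ℝ) {p : CotangentBundle I M} (hp : p.2 = 0) :
    scaleCovector t p = p := by
  rw [scaleCovector, hp, smul_zero]
  exact congrArg (TotalSpace.mk p.1) hp.symm

variable [IsManifold I ∞ M]

theorem isOpen_nonzeroCovectors : IsOpen (nonzeroCovectors I M) := by
  refine isOpen_iff_mem_nhds.2 fun p hp => ?_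
  have h0 : fiberCoord p.1 p ≠ 0 := by rwa [fiberCoord_self]
  have h := (hasMFDerivAt_fiberCoord p).1.eventually_ne h0
  filter_upwards [h] with q hq h0
  exact hq (by rw [fiberCoord_eq, h0]; rfl)

theorem IsStarHamiltonian.eq_zero {h : CotangentBundle I M → ℝ} (hh : IsStarHamiltonian h)
    {p : CotangentBundle I M} (hp : p.2 = 0) : h p = 0 := by
  have := hh.homogeneous 2 p two_pos
  rw [scaleCovector_of_eq_zero _ hp] at this
  linarith

theorem IsStarHamiltonian.mem_of_pos {h : CotangentBundle I M → ℝ} (hh : IsStarHamiltonian h)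
    {p : CotangentBundle I M} (hp : 0 < h p) : p ∈ nonzeroCovectors I M :=
  fun h0 => hp.ne' (hh.eq_zero h0)

theorem IsStarHamiltonian.radialFunction_eq {h : CotangentBundle I M → ℝ}
    (hh : IsStarHamiltonian h) (p : CotangentBundle I M) :
    radialFunction {q | h q ≤ 1} p = 1 / h p := by
  by_cases hp : p.2 = 0
  · have : {t : ℝ | 0 < t ∧ scaleCovector t p ∈ {q | h q ≤ 1}} = Ioi 0 := by
      ext t
      simp only [scaleCovector_of_eq_zero t hp, mem_ofPred_eq, hh.eq_zero hp, mem_Ioi, zero_le_one,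
        and_true]
    rw [radialFunction, this, hh.eq_zero hp, div_zero, Real.sSup_of_not_bddAbove (not_bddAbove_Ioi 0)]
  · exact radialFunction_sublevel hh hp

/-! ### Special homogeneous transformations -/

variable {n : ℕ} {φ : PartialEquiv (CotangentBundle I M) (CotangentBundle I M)}

namespace IsSpecialHomogeneous

theorem map_mem (hφ : IsSpecialHomogeneous n φ) {p : CotangentBundle I M}
    (hp : p ∈ nonzeroCovectors I M) : φ p ∈ nonzeroCovectors I M :=
  hφ.target_eq ▸ φ.map_source (hφ.source_eq.symm ▸ hp)

theorem symm_map_mem (hφ : IsSpecialHomogeneous n φ) {p : CotangentBundle I M}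
    (hp : p ∈ nonzeroCovectors I M) : φ.symm p ∈ nonzeroCovectors I M :=
  hφ.source_eq ▸ φ.map_target (hφ.target_eq.symm ▸ hp)

theorem left_inv (hφ : IsSpecialHomogeneous n φ) {p : CotangentBundle I M}
    (hp : p ∈ nonzeroCovectors I M) : φ.symm (φ p) = p :=
  φ.left_inv (hφ.source_eq.symm ▸ hp)

theorem right_inv (hφ : IsSpecialHomogeneous n φ) {p : CotangentBundle I M}
    (hp : p ∈ nonzeroCovectors I M) : φ (φ.symm p) = p :=
  φ.right_inv (hφ.target_eq.symm ▸ hp)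

theorem mdifferentiableAt (hφ : IsSpecialHomogeneous n φ) {p : CotangentBundle I M}
    (hp : p ∈ nonzeroCovectors I M) :
    MDifferentiableAt (cotangentModel I) (cotangentModel I) φ p :=
  (hφ.smooth.contMDiffAt (isOpen_nonzeroCovectors.mem_nhds hp)).mdifferentiableAt (by simp)

protected theorem symm (hφ : IsSpecialHomogeneous n φ) : IsSpecialHomogeneous n φ.symm where
  source_eq := hφ.target_eq
  target_eq := hφ.source_eq
  smooth := hφ.smooth_symm
  smooth_symm := hφ.smooth
  homogeneous p hp t ht := by
    have h1 := hφ.symm_map_mem hp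
    rw [← hφ.left_inv (scaleCovector_mem ht h1), hφ.homogeneous _ h1 t ht, hφ.right_inv hp]
  preserves p hp v := by
    have h1 := hφ.symm_map_mem hp
    have hd : MDifferentiableAt (cotangentModel I) (cotangentModel I) φ.symm p :=
      (hφ.smooth_symm.contMDiffAt (isOpen_nonzeroCovectors.mem_nhds hp)).mdifferentiableAt (by simp)
    have h2 := (hφ.mdifferentiableAt h1).hasMFDerivAt.comp p hd.hasMFDerivAt
    have h3 : HasMFDerivAt (cotangentModel I) (cotangentModel I) (φ ∘ φ.symm) p
        (ContinuousLinearMap.id ℝ (E × (E →L[ℝ] ℝ))) := by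
      refine (hasMFDerivAt_id p).congr_of_eventuallyEq ?_
      filter_upwards [isOpen_nonzeroCovectors.mem_nhds hp] with q hq
      exact hφ.right_inv hq
    have h4 := hasMFDerivAt_unique h2 h3
    rw [← hφ.preserves _ h1]
    have h5 : (fun i => mfderiv (cotangentModel I) (cotangentModel I) φ (φ.symm p)
        (mfderiv (cotangentModel I) (cotangentModel I) φ.symm p (v i))) =
          (show Fin (1 + 2 * (n - 1)) → TangentSpace (cotangentModel I) (φ (φ.symm p)) from v) := by
      funext i
      exact congrArg (fun L : E × (E →L[ℝ] ℝ) →L[ℝ] E × (E →L[ℝ] ℝ) => L (v i)) h4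
    rw [h5, omegaForm_eq, omegaForm_eq, hφ.right_inv hp]

theorem mfderiv_euler (hφ : IsSpecialHomogeneous n φ) {p : CotangentBundle I M}
    (hp : p ∈ nonzeroCovectors I M) :
    mfderiv (cotangentModel I) (cotangentModel I) φ p ((0 : E), (p.2 : E →L[ℝ] ℝ)) =
      ((0 : E), ((φ p).2 : E →L[ℝ] ℝ)) := by
  have h1 : HasMFDerivAt (cotangentModel I) (cotangentModel I) φ (scaleCovector 1 p)
      (mfderiv (cotangentModel I) (cotangentModel I) φ p) := by
    rw [scaleCovector_one]
    exact (hφ.mdifferentiableAt hp).hasMFDerivAt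
  have h2 := HasMFDerivAt.comp (1 : ℝ) h1 (hasMFDerivAt_scaleCovector_curve p)
  have h3 : HasMFDerivAt 𝓘(ℝ, ℝ) (cotangentModel I) (φ ∘ fun t : ℝ => scaleCovector t p) 1
      ((0 : ℝ →L[ℝ] E).prod (ContinuousLinearMap.toSpanSingleton ℝ ((φ p).2 : E →L[ℝ] ℝ))) := by
    refine (hasMFDerivAt_scaleCovector_curve (φ p)).congr_of_eventuallyEq ?_
    filter_upwards [lt_mem_nhds (zero_lt_one (α := ℝ))] with t ht
    exact hφ.homogeneous p hp t ht
  have h4 := congrArg (fun L : ℝ →L[ℝ] E × (E →L[ℝ] ℝ) => L 1) (hasMFDerivAt_unique h2 h3)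
  have h5 : ∀ q : CotangentBundle I M, (0 : ℝ →L[ℝ] E).prod
      (ContinuousLinearMap.toSpanSingleton ℝ (q.2 : E →L[ℝ] ℝ)) 1 = (0, q.2) :=
    fun q => Prod.ext rfl (one_smul ℝ _)
  exact ((congrArg (mfderiv (cotangentModel I) (cotangentModel I) φ p) (h5 p)).symm.trans h4).trans
    (h5 (φ p))

/-- A special homogeneous transformation preserves the Liouville form. -/
theorem preserves_liouvilleForm [FiniteDimensional ℝ E] (hn : 1 ≤ n)
    (hdim : Module.finrank ℝ E = n) (hφ : IsSpecialHomogeneous n φ) {p : CotangentBundle I M}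
    (hp : p ∈ nonzeroCovectors I M) (v : Fin (2 * n) → TangentSpace (cotangentModel I) p) :
    liouvilleForm n (φ p) (fun i => mfderiv (cotangentModel I) (cotangentModel I) φ p (v i)) =
      liouvilleForm n p v := by
  obtain ⟨k, rfl⟩ := Nat.exists_eq_add_of_le' hn
  let A : E × (E →L[ℝ] ℝ) →L[ℝ] E × (E →L[ℝ] ℝ) :=
    mfderiv (cotangentModel I) (cotangentModel I) φ p
  let ξ : E →L[ℝ] ℝ := p.2
  let ξ' : E →L[ℝ] ℝ := (φ p).2
  set f := wedgePower (bilinAlt (cotangentPairing E)) (k + 1)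
  have hV : Module.finrank ℝ (E × (E →L[ℝ] ℝ)) = 2 * (k + 1) := by
    rw [Module.finrank_prod,
      (LinearMap.toContinuousLinearMap (𝕜 := ℝ) (E := E) (F' := ℝ)).symm.finrank_eq,
      Subspace.dual_finrank_eq, hdim, two_mul]
  have hX : ((0 : E), (p.2 : E →L[ℝ] ℝ)) ≠ 0 := fun h => hp (congrArg Prod.snd h)
  have key : f.compLinearMap A.toLinearMap = f := by
    refine AlternatingMap.ext_of_insert hV hX 0 fun u hu => ?_
    have h1 := wedgePower_interior (liftCovector ξ) (cotangentPairing E) (X := (0, ξ))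
      (fun y => rfl) (fun x => map_zero x.2) k u hu
    have h2 := wedgePower_interior (liftCovector ξ') (cotangentPairing E) (X := (0, ξ'))
      (fun y => rfl) (fun x => map_zero x.2) k
      (fun i => A (u i)) ((congrArg A hu).trans (hφ.mfderiv_euler hp))
    refine h2.trans (Eq.trans ?_ h1.symm)
    have h3 := ((omegaForm_eq (k + 1) (φ p) _).symm.trans
      (hφ.preserves p hp fun j => u ⟨j + 1, by omega⟩)).trans (omegaForm_eq (k + 1) p _)
    exact congrArg _ (mul_left_cancel₀ (by positivity) h3)
  rw [liouvilleForm_eq, liouvilleForm_eq]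
  exact congrArg _ (congrArg (fun g => g v) key)

end IsSpecialHomogeneous

theorem omegaForm_scaleCovector (hn : 1 ≤ n) {s : CotangentBundle I M → ℝ} {p : CotangentBundle I M}
    (hs : MDifferentiableAt (cotangentModel I) 𝓘(ℝ, ℝ) s p) (hs0 : s p ≠ 0)
    (v : Fin (1 + 2 * (n - 1)) → TangentSpace (cotangentModel I) p) :
    omegaForm n (scaleCovector (s p) p) (fun i => mfderiv (cotangentModel I) (cotangentModel I)
      (fun q => scaleCovector (s q) q) p (v i)) = s p ^ n * omegaForm n p v := by
  obtain ⟨k, rfl⟩ := Nat.exists_eq_add_of_le' hn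
  let ℓ : E × (E →L[ℝ] ℝ) →L[ℝ] ℝ := mfderiv (cotangentModel I) 𝓘(ℝ, ℝ) s p
  have hd := hasMFDerivAt_scaleCovector (ℓ := ℓ) hs.hasMFDerivAt
  rw [hd.mfderiv, omegaForm_eq, omegaForm_eq]
  let w : Fin (1 + 2 * k) → E × (E →L[ℝ] ℝ) := v
  let ξ : E →L[ℝ] ℝ := p.2
  let X : E × (E →L[ℝ] ℝ) := (0, ξ)
  let L : E × (E →L[ℝ] ℝ) → E × (E →L[ℝ] ℝ) := fun x => (x.1, s p • x.2)
  have h1 := AlternatingMap.map_add_smul_of_annihilates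
    (wedgeProduct (linAlt (liftCovector ξ)) (wedgePower (bilinAlt (cotangentPairing E)) k))
    (linAlt_wedge_eq_zero (liftCovector ξ) (cotangentPairing E) (X := X) (fun y => rfl)
      (fun x => map_zero x.2) k) w (fun i => ℓ (w i) / s p)
  have h2 := linAlt_wedge_map_of_scaling (a := liftCovector ξ) (b := cotangentPairing E)
    (a' := liftCovector (s p • ξ)) (b' := cotangentPairing E) (L := L) (c := s p)
    (fun x => rfl) (fun x y => rfl) k (fun i => w i + (ℓ (w i) / s p) • X)
  rw [h1] at h2
  rw [mul_left_comm]
  refine congrArg _ (Eq.trans (congrArg _ ?_) h2)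
  funext i
  refine Prod.ext ?_ ?_
  · change (w i).1 = (w i).1 + (ℓ (w i) / s p) • (0 : E)
    rw [smul_zero, add_zero]
  · change s p • (w i).2 + ℓ (w i) • ξ =
      s p • ((w i).2 + (ℓ (w i) / s p) • ξ)
    rw [smul_add, smul_smul, mul_div_cancel₀ _ hs0]

end StarGeometry

section StarBodyTransform
open Filter Topology

variable {E : Type*} [NormedAddCommGroup E] [NormedSpace ℝ E] {H : Type*} [TopologicalSpace H]
  {I : ModelWithCorners ℝ E H} {M : Type*} [TopologicalSpace M] [ChartedSpace H M]
  {n : ℕ} {φ : PartialEquiv (CotangentBundle I M) (CotangentBundle I M)}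

open Classical in
/-- The Hamiltonian of the image of a star body under a transformation of `T*M ∖ 0`. -/
def transformHamiltonian (φ : PartialEquiv (CotangentBundle I M) (CotangentBundle I M))
    (h : CotangentBundle I M → ℝ) (p : CotangentBundle I M) : ℝ :=
  if p.2 = 0 then 0 else h (φ.symm p)

theorem transformHamiltonian_of_mem (h : CotangentBundle I M → ℝ) {p : CotangentBundle I M}
    (hp : p ∈ nonzeroCovectors I M) : transformHamiltonian φ h p = h (φ.symm p) :=
  if_neg hp

theorem transformHamiltonian_of_eq_zero (h : CotangentBundle I M → ℝ) {p : CotangentBundle I M}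
    (hp : p.2 = 0) : transformHamiltonian φ h p = 0 :=
  if_pos hp

open Classical in
/-- A homogeneous map followed by the radial projection onto `{h = 1}`, extended by the identity
to the zero section. -/
def radialMap (φ : PartialEquiv (CotangentBundle I M) (CotangentBundle I M))
    (h : CotangentBundle I M → ℝ) (p : CotangentBundle I M) : CotangentBundle I M :=
  if p.2 = 0 then p else scaleCovector (1 / h (φ p)) (φ p)

theorem radialMap_of_mem (φ : PartialEquiv (CotangentBundle I M) (CotangentBundle I M))
    (h : CotangentBundle I M → ℝ) {p : CotangentBundle I M} (hp : p ∈ nonzeroCovectors I M) :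
    radialMap φ h p = scaleCovector (1 / h (φ p)) (φ p) :=
  if_neg hp

variable [IsManifold I ∞ M]

namespace IsSpecialHomogeneous

theorem transformBody_eq (hφ : IsSpecialHomogeneous n φ) (h : CotangentBundle I M → ℝ) :
    transformBody φ {p | h p ≤ 1} = {p | transformHamiltonian φ h p ≤ 1} := by
  ext p
  by_cases hp : p.2 = 0
  · simp [transformBody, hp, transformHamiltonian_of_eq_zero h hp]
  · rw [mem_ofPred_eq, transformHamiltonian_of_mem h hp]
    refine ⟨?_, fun h1 => Or.inl ⟨φ.symm p, ⟨h1, hφ.symm_map_mem hp⟩, hφ.right_inv hp⟩⟩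
    rintro (⟨q, ⟨hq, hq0⟩, rfl⟩ | h0)
    · rwa [hφ.left_inv hq0]
    · exact absurd h0 hp

/-- A homogeneous transformation distorts a star Hamiltonian by bounded factors. -/
theorem exists_bounds (hφ : IsSpecialHomogeneous n φ) {h : CotangentBundle I M → ℝ}
    (hh : IsStarHamiltonian h) : ∃ c C : ℝ, 0 < c ∧ 0 < C ∧ ∀ p,
      c * h p ≤ transformHamiltonian φ h p ∧ transformHamiltonian φ h p ≤ C * h p := by
  have hK : IsCompact (h ⁻¹' {1}) := hh.proper.isCompact_preimage isCompact_singleton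
  have hKO : ∀ p ∈ h ⁻¹' {1}, p ∈ nonzeroCovectors I M := fun p hp =>
    hh.mem_of_pos (by rw [show h p = 1 from hp]; exact one_pos)
  have hc : ContinuousOn (fun p => h (φ.symm p)) (h ⁻¹' {1}) :=
    hh.continuous.comp_continuousOn (hφ.smooth_symm.continuousOn.mono hKO)
  obtain ⟨c, C, hc0, hC0, hb⟩ : ∃ c C : ℝ, 0 < c ∧ 0 < C ∧ ∀ p ∈ h ⁻¹' {1},
      c ≤ h (φ.symm p) ∧ h (φ.symm p) ≤ C := by
    rcases (h ⁻¹' {1}).eq_empty_or_nonempty with he | hne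
    · exact ⟨1, 1, one_pos, one_pos, by simp [he]⟩
    · obtain ⟨a, ha, hmin⟩ := hK.exists_isMinOn hne hc
      obtain ⟨b, hb, hmax⟩ := hK.exists_isMaxOn hne hc
      exact ⟨_, _, hh.pos _ (hφ.symm_map_mem (hKO a ha)), hh.pos _ (hφ.symm_map_mem (hKO b hb)),
        fun p hp => ⟨hmin hp, hmax hp⟩⟩
  refine ⟨c, C, hc0, hC0, fun p => ?_⟩
  by_cases hp : p.2 = 0
  · simp [transformHamiltonian_of_eq_zero h hp, hh.eq_zero hp]
  · have hpos := hh.pos p hp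
    have h1 : h (scaleCovector (h p)⁻¹ p) = 1 := by
      rw [hh.homogeneous _ _ (inv_pos.2 hpos), inv_mul_cancel₀ hpos.ne']
    have h2 := hb _ h1
    rw [hφ.symm.homogeneous p hp _ (inv_pos.2 hpos), hh.homogeneous _ _ (inv_pos.2 hpos),
      inv_mul_eq_div, le_div_iff₀ hpos, div_le_iff₀ hpos] at h2
    rwa [transformHamiltonian_of_mem h hp]

theorem isStarHamiltonian (hφ : IsSpecialHomogeneous n φ) {h : CotangentBundle I M → ℝ}
    (hh : IsStarHamiltonian h) : IsStarHamiltonian (transformHamiltonian φ h) := by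
  obtain ⟨c, C, hc0, hC0, hb⟩ := hφ.exists_bounds hh
  have hnn : ∀ p, 0 ≤ transformHamiltonian φ h p := fun p =>
    (mul_nonneg hc0.le (hh.nonneg p)).trans (hb p).1
  have hcont : Continuous (transformHamiltonian φ h) := by
    refine continuous_iff_continuousAt.2 fun p => ?_
    by_cases hp : p.2 = 0
    · rw [ContinuousAt, transformHamiltonian_of_eq_zero h hp]
      refine squeeze_zero hnn (fun q => (hb q).2) ?_
      have := (hh.continuous.const_mul C).tendsto p
      rwa [hh.eq_zero hp, mul_zero] at this
    · have hO := isOpen_nonzeroCovectors.mem_nhds (show p ∈ nonzeroCovectors I M from hp)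
      refine (hh.continuous.continuousAt.comp (hφ.smooth_symm.continuousOn.continuousAt hO)).congr ?_
      filter_upwards [hO] with q hq
      exact (transformHamiltonian_of_mem h hq).symm
  refine ⟨hcont, hnn, fun p hp => ?_, fun t p ht => ?_, ?_⟩
  · rw [transformHamiltonian_of_mem h hp]
    exact hh.pos _ (hφ.symm_map_mem hp)
  · by_cases hp : p.2 = 0
    · rw [scaleCovector_of_eq_zero t hp, transformHamiltonian_of_eq_zero h hp, mul_zero]
    · rw [transformHamiltonian_of_mem h hp, transformHamiltonian_of_mem h (scaleCovector_mem ht hp),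
        hφ.symm.homogeneous p hp t ht, hh.homogeneous _ _ ht]
  · refine isProperMap_iff_isCompact_preimage.2 ⟨hcont, fun K hK => ?_⟩
    obtain ⟨R, hR⟩ := hK.bddAbove
    refine (hh.proper.isCompact_preimage (isCompact_Icc (a := 0) (b := R / c))).of_isClosed_subset
      (hK.isClosed.preimage hcont) fun p hp => ⟨hh.nonneg p, ?_⟩
    rw [le_div_iff₀' hc0]
    exact (hb p).1.trans (hR hp)

theorem isStarBody (hφ : IsSpecialHomogeneous n φ) {A : Set (CotangentBundle I M)}
    (hA : IsStarBody A) : IsStarBody (transformBody φ A) := by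
  obtain ⟨h, hh, rfl⟩ := hA
  exact ⟨_, hφ.isStarHamiltonian hh, hφ.transformBody_eq h⟩

theorem transformBody_symm (hφ : IsSpecialHomogeneous n φ) {A : Set (CotangentBundle I M)}
    (hA : IsStarBody A) : transformBody φ.symm (transformBody φ A) = A := by
  obtain ⟨h, hh, rfl⟩ := hA
  rw [hφ.transformBody_eq, hφ.symm.transformBody_eq]
  ext p
  by_cases hp : p.2 = 0
  · simp [transformHamiltonian_of_eq_zero _ hp, hh.eq_zero hp]
  · rw [mem_ofPred_eq, transformHamiltonian_of_mem _ hp, PartialEquiv.symm_symm,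
      transformHamiltonian_of_mem _ (hφ.map_mem hp), hφ.left_inv hp, mem_ofPred_eq]

theorem radialFunction_transformBody (hφ : IsSpecialHomogeneous n φ) {A : Set (CotangentBundle I M)}
    (hA : IsStarBody A) {p : CotangentBundle I M} (hp : p ∈ nonzeroCovectors I M) :
    radialFunction (transformBody φ A) p = radialFunction A (φ.symm p) := by
  obtain ⟨h, hh, rfl⟩ := hA
  rw [hφ.transformBody_eq, (hφ.isStarHamiltonian hh).radialFunction_eq, hh.radialFunction_eq,
    transformHamiltonian_of_mem h hp]

end IsSpecialHomogeneous

theorem IsStarBody.measurable_radialFunction {A : Set (CotangentBundle I M)} (hA : IsStarBody A) :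
    Measurable (radialFunction A) := by
  obtain ⟨h, hh, rfl⟩ := hA
  rw [funext hh.radialFunction_eq]
  exact measurable_const.div hh.continuous.measurable

theorem IsStarBody.radialFunction_nonneg {A : Set (CotangentBundle I M)} (hA : IsStarBody A)
    (p : CotangentBundle I M) : 0 ≤ radialFunction A p := by
  obtain ⟨h, hh, rfl⟩ := hA
  rw [hh.radialFunction_eq]
  exact one_div_nonneg.2 (hh.nonneg p)

theorem IsStarBody.radialFunction_scaleCovector {A : Set (CotangentBundle I M)} (hA : IsStarBody A)
    {t : ℝ} (ht : 0 < t) (p : CotangentBundle I M) :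
    radialFunction A (scaleCovector t p) = t⁻¹ * radialFunction A p := by
  obtain ⟨h, hh, rfl⟩ := hA
  rw [hh.radialFunction_eq, hh.radialFunction_eq, hh.homogeneous t p ht, one_div, mul_inv, one_div]

theorem IsStarBody.radialFunction_mono {A B : Set (CotangentBundle I M)} (hA : IsStarBody A)
    (hB : IsStarBody B) (hAB : A ⊆ B) (p : CotangentBundle I M) :
    radialFunction A p ≤ radialFunction B p := by
  by_cases hp : p.2 = 0
  · obtain ⟨h, hh, rfl⟩ := hA
    obtain ⟨h', hh', rfl⟩ := hB
    rw [hh.radialFunction_eq, hh'.radialFunction_eq, hh.eq_zero hp, hh'.eq_zero hp]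
  · obtain ⟨h, hh, rfl⟩ := hA
    obtain ⟨h', hh', rfl⟩ := hB
    have h0 := hh.pos p hp
    have h0' := hh'.pos p hp
    rw [hh.radialFunction_eq, hh'.radialFunction_eq]
    refine one_div_le_one_div_of_le h0' ?_
    have h1 : scaleCovector (h p)⁻¹ p ∈ {q | h q ≤ 1} := by
      rw [mem_ofPred_eq, hh.homogeneous _ _ (inv_pos.2 h0), inv_mul_cancel₀ h0.ne']
    have h2 := hAB h1
    rwa [mem_ofPred_eq, hh'.homogeneous _ _ (inv_pos.2 h0), inv_mul_le_one₀ h0] at h2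

theorem measurableSet_radialSum {A B : Set (CotangentBundle I M)} (hA : IsStarBody A)
    (hB : IsStarBody B) : MeasurableSet (radialSum A B) := by
  have h : {p : CotangentBundle I M | p.2 = 0} = (nonzeroCovectors I M)ᶜ :=
    Set.ext fun p => not_not.symm
  have h0 : MeasurableSet {p : CotangentBundle I M | p.2 = 0} :=
    h ▸ isOpen_nonzeroCovectors.measurableSet.compl
  exact h0.union (measurableSet_le measurable_const
    (hA.measurable_radialFunction.add hB.measurable_radialFunction))

theorem measurable_of_continuousOn_nonzeroCovectors {Y : Type*} [TopologicalSpace Y]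
    [MeasurableSpace Y] [BorelSpace Y] {f g : CotangentBundle I M → Y}
    (hf : ContinuousOn f (nonzeroCovectors I M)) (hg : Measurable g)
    (hfg : ∀ p, p.2 = 0 → f p = g p) : Measurable f := by
  refine measurable_of_restrict_of_restrict_compl isOpen_nonzeroCovectors.measurableSet
    hf.domRestrict.measurable ?_
  have : (nonzeroCovectors I M)ᶜ.domRestrict f = fun p => g p.1 :=
    funext fun p => hfg p.1 (not_not.1 p.2)
  rw [this]
  exact hg.comp measurable_subtype_coe

namespace IsSpecialHomogeneous

theorem contMDiffOn_radialMap (hφ : IsSpecialHomogeneous n φ) {h : CotangentBundle I M → ℝ}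
    (hh : IsSmoothStarHamiltonian h) :
    ContMDiffOn (cotangentModel I) (cotangentModel I) ∞ (radialMap φ h) (nonzeroCovectors I M) := by
  intro p hp
  have hO := isOpen_nonzeroCovectors.mem_nhds hp
  have h1 := hφ.smooth.contMDiffAt hO
  have h2 : ContMDiffAt (cotangentModel I) 𝓘(ℝ, ℝ) ∞ (fun p => 1 / h (φ p)) p := by
    have h3 : ContMDiffAt (cotangentModel I) 𝓘(ℝ, ℝ) ∞ (h ∘ φ) p :=
      (hh.smooth.contMDiffAt (isOpen_nonzeroCovectors.mem_nhds (hφ.map_mem hp))).comp p h1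
    have h4 : ContMDiffAt 𝓘(ℝ, ℝ) 𝓘(ℝ, ℝ) ∞ (fun t : ℝ => 1 / t) (h (φ p)) :=
      (contDiffAt_const.div contDiffAt_id (hh.pos _ (hφ.map_mem hp)).ne').contMDiffAt
    exact h4.comp p h3
  refine ContMDiffAt.contMDiffWithinAt ((contMDiffAt_scaleCovector h2 h1).congr_of_eventuallyEq ?_)
  filter_upwards [hO] with q hq
  exact radialMap_of_mem φ h hq

theorem measurable_radialMap (hφ : IsSpecialHomogeneous n φ) {h : CotangentBundle I M → ℝ}
    (hh : IsSmoothStarHamiltonian h) : Measurable (radialMap φ h) := by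
  refine measurable_of_continuousOn_nonzeroCovectors (hφ.contMDiffOn_radialMap hh).continuousOn
    measurable_id fun p hp => if_pos hp

/-- The pull-back of `Ω` under a special homogeneous map followed by a radial projection. -/
theorem omegaForm_radialMap (hn : 1 ≤ n) (hφ : IsSpecialHomogeneous n φ)
    {h : CotangentBundle I M → ℝ} (hh : IsSmoothStarHamiltonian h) {p : CotangentBundle I M}
    (hp : p ∈ nonzeroCovectors I M) (v : Fin (1 + 2 * (n - 1)) → TangentSpace (cotangentModel I) p) :
    omegaForm n (radialMap φ h p)
      (fun i => mfderiv (cotangentModel I) (cotangentModel I) (radialMap φ h) p (v i)) =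
      (1 / h (φ p)) ^ n * omegaForm n p v := by
  have hp' := hφ.map_mem hp
  have hs : MDifferentiableAt (cotangentModel I) 𝓘(ℝ, ℝ) (fun q => 1 / h q) (φ p) := by
    have h4 : ContMDiffAt 𝓘(ℝ, ℝ) 𝓘(ℝ, ℝ) ∞ (fun t : ℝ => 1 / t) (h (φ p)) :=
      (contDiffAt_const.div contDiffAt_id (hh.pos _ hp').ne').contMDiffAt
    exact (h4.comp _ (hh.smooth.contMDiffAt (isOpen_nonzeroCovectors.mem_nhds hp'))).mdifferentiableAt
      (by simp)
  let r : CotangentBundle I M → CotangentBundle I M := fun q => scaleCovector (1 / h q) q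
  have hr : MDifferentiableAt (cotangentModel I) (cotangentModel I) r (φ p) :=
    (hasMFDerivAt_scaleCovector hs.hasMFDerivAt).mdifferentiableAt
  have hc := hr.hasMFDerivAt.comp p (hφ.mdifferentiableAt hp).hasMFDerivAt
  have he : radialMap φ h =ᶠ[𝓝 p] r ∘ φ := by
    filter_upwards [isOpen_nonzeroCovectors.mem_nhds hp] with q hq
    exact radialMap_of_mem φ h hq
  rw [(hc.congr_of_eventuallyEq he).mfderiv, ← hφ.preserves p hp,
    ← omegaForm_scaleCovector hn hs (one_div_pos.2 (hh.pos _ hp')).ne', omegaForm_eq, omegaForm_eq,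
    radialMap_of_mem φ h hp]
  rfl

theorem symplecticVolume_radialSum_le [FiniteDimensional ℝ E] (hn : 1 ≤ n)
    (hdim : Module.finrank ℝ E = n) (hφ : IsSpecialHomogeneous n φ)
    {A B : Set (CotangentBundle I M)} (hA : IsStarBody A) (hB : IsStarBody B) :
    symplecticVolume n (radialSum A B) ≤
      symplecticVolume n (radialSum (transformBody φ A) (transformBody φ B)) := by
  classical
  have hO := isOpen_nonzeroCovectors (I := I) (M := M)
  have hX := measurableSet_radialSum hA hB
  set X := radialSum A B
  set Y := radialSum (transformBody φ A) (transformBody φ B)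
  let θ : CotangentBundle I M → CotangentBundle I M := fun q => if q.2 = 0 then q else φ.symm q
  have hθO : ∀ q ∈ nonzeroCovectors I M, θ q = φ.symm q := fun q hq => if_neg hq
  have hθ : ContMDiffOn (cotangentModel I) (cotangentModel I) ∞ θ (nonzeroCovectors I M) :=
    hφ.smooth_symm.congr hθO
  have hθm : Measurable θ := measurable_of_continuousOn_nonzeroCovectors hθ.continuousOn
    measurable_id fun q hq => if_pos hq
  have htr := formMeasure_le_map_withDensity (W := fun _ => 1) hO hO subset_rfl subset_rfl hφ.smooth
    hθ hθm (fun p hp => hφ.map_mem hp)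
    (fun p hp => (hθO _ (hφ.map_mem hp)).trans (hφ.left_inv hp)) measurable_const
    (fun _ _ => one_ne_zero) (fun _ _ => ENNReal.one_ne_top) (η := liouvilleForm n)
    (η' := liouvilleForm n) (fun p hp v => by
      rw [hφ.preserves_liouvilleForm hn hdim hp, one_mul])
  rw [show (fun _ => 1 : CotangentBundle I M → ℝ≥0∞) = 1 from rfl, withDensity_one] at htr
  set μ := formMeasure (cotangentModel I) univ (liouvilleForm (I := I) (M := M) n)
  set ν := formMeasure (cotangentModel I) (nonzeroCovectors I M) (liouvilleForm (I := I) (M := M) n)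
  have hsub : θ ⁻¹' X ∩ nonzeroCovectors I M ⊆ Y ∩ nonzeroCovectors I M := by
    rintro q ⟨hq, hq0⟩
    refine ⟨?_, hq0⟩
    rw [mem_preimage, hθO q hq0] at hq
    rcases hq with h0 | h1
    · exact absurd h0 (hφ.symm_map_mem hq0)
    · refine Or.inr ?_
      rwa [hφ.radialFunction_transformBody hA hq0, hφ.radialFunction_transformBody hB hq0]
  have hν : ν X ≤ μ (Y ∩ nonzeroCovectors I M) := calc
    ν X ≤ ν (θ ⁻¹' X) := (htr X).trans_eq (Measure.map_apply hθm hX)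
    _ ≤ ν (θ ⁻¹' X ∩ nonzeroCovectors I M) + ν (θ ⁻¹' X \ nonzeroCovectors I M) :=
        measure_le_inter_add_sdiff _ _ _
    _ = ν (θ ⁻¹' X ∩ nonzeroCovectors I M) := by
        rw [measure_mono_null (s := θ ⁻¹' X \ nonzeroCovectors I M) (fun q hq => hq.2)
          (formMeasure_compl hO.measurableSet _), add_zero]
    _ ≤ μ (Y ∩ nonzeroCovectors I M) :=
        (formMeasure_mono (subset_univ _) _ _).trans (measure_mono hsub)
  have hle : μ X ≤ ν X + μ (X ∩ (nonzeroCovectors I M)ᶜ) := by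
    have := formMeasure_le_add (J := cotangentModel I) (S := univ) hO
      (liouvilleForm (I := I) (M := M) n) X
    rwa [univ_inter, Measure.add_apply, Measure.restrict_apply hX] at this
  calc μ X ≤ ν X + μ (X ∩ (nonzeroCovectors I M)ᶜ) := hle
    _ ≤ μ (Y ∩ nonzeroCovectors I M) + μ (Y \ nonzeroCovectors I M) := by
        refine add_le_add hν (measure_mono fun q hq => ⟨Or.inl ?_, hq.2⟩)
        exact not_not.1 hq.2
    _ = μ Y := measure_inter_add_sdiff _ hO.measurableSet

theorem dualMixedVolume_le (hn : 1 ≤ n) (hφ : IsSpecialHomogeneous n φ)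
    {h₀ h₁ : CotangentBundle I M → ℝ} (hh₀ : IsSmoothStarHamiltonian h₀)
    (hh₁ : IsSmoothStarHamiltonian h₁) {A : Fin n → Set (CotangentBundle I M)}
    (hA : ∀ i, IsStarBody (A i)) :
    dualMixedVolume n h₀ A ≤ dualMixedVolume n h₁ fun i => transformBody φ (A i) := by
  classical
  have hO := isOpen_nonzeroCovectors (I := I) (M := M)
  have hmem : ∀ {h : CotangentBundle I M → ℝ}, IsSmoothStarHamiltonian h →
      {p | h p = 1} ⊆ nonzeroCovectors I M := fun hh p hp =>
    hh.mem_of_pos (by rw [show _ = (1 : ℝ) from hp]; exact one_pos)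
  let W : CotangentBundle I M → ℝ≥0∞ := fun q =>
    if q.2 = 0 then 0 else ENNReal.ofReal ((1 / h₀ (φ.symm q)) ^ n)
  have hWO : ∀ q ∈ nonzeroCovectors I M, W q = ENNReal.ofReal ((1 / h₀ (φ.symm q)) ^ n) :=
    fun q hq => if_neg hq
  have hW : Measurable W := by
    refine measurable_of_continuousOn_nonzeroCovectors ?_ (measurable_const (a := 0))
      fun q hq => if_pos hq
    · refine ContinuousOn.congr ?_ hWO
      refine ENNReal.continuous_ofReal.comp_continuousOn (ContinuousOn.pow ?_ n)
      exact continuousOn_const.div (hh₀.continuous.comp_continuousOn hφ.smooth_symm.continuousOn)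
        fun q hq => (hh₀.pos _ (hφ.symm_map_mem hq)).ne'
  have hψmem : ∀ p ∈ nonzeroCovectors I M, radialMap φ h₁ p ∈ nonzeroCovectors I M := fun p hp => by
    rw [radialMap_of_mem φ h₁ hp]
    exact scaleCovector_mem (one_div_pos.2 (hh₁.pos _ (hφ.map_mem hp))) (hφ.map_mem hp)
  have hsymm : ∀ p ∈ nonzeroCovectors I M, φ.symm (radialMap φ h₁ p) =
      scaleCovector (1 / h₁ (φ p)) p := fun p hp => by
    rw [radialMap_of_mem φ h₁ hp, hφ.symm.homogeneous _ (hφ.map_mem hp) _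
      (one_div_pos.2 (hh₁.pos _ (hφ.map_mem hp))), hφ.left_inv hp]
  have hval : ∀ p ∈ {p | h₀ p = 1}, h₀ (φ.symm (radialMap φ h₁ p)) = 1 / h₁ (φ p) := fun p hp => by
    have hp' := hmem hh₀ hp
    rw [hsymm p hp', hh₀.homogeneous _ _ (one_div_pos.2 (hh₁.pos _ (hφ.map_mem hp'))),
      show h₀ p = 1 from hp, mul_one]
  have hpos : ∀ p ∈ {p | h₀ p = 1}, 0 < h₁ (φ p) := fun p hp =>
    hh₁.pos _ (hφ.map_mem (hmem hh₀ hp))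
  have hWval : ∀ p ∈ {p | h₀ p = 1}, W (radialMap φ h₁ p) = ENNReal.ofReal (h₁ (φ p) ^ n) :=
    fun p hp => by rw [hWO _ (hψmem p (hmem hh₀ hp)), hval p hp, one_div_one_div]
  have htr := formMeasure_le_map_withDensity (S := {p | h₀ p = 1}) (S' := {p | h₁ p = 1}) hO hO
    (hmem hh₀) (hmem hh₁) (hφ.contMDiffOn_radialMap hh₁) (hφ.symm.contMDiffOn_radialMap hh₀)
    (hφ.symm.measurable_radialMap hh₀) (fun p hp => ?_) (fun p hp => ?_) hW
    (fun p hp => ?_) (fun p hp => ?_) (η := omegaForm n) (η' := omegaForm n) (fun p hp v => ?_)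
  · have hFm : ∀ {A : Fin n → Set (CotangentBundle I M)}, (∀ i, IsStarBody (A i)) →
        Measurable fun p => ENNReal.ofReal (∏ i, radialFunction (A i) p) := fun hA =>
      ENNReal.measurable_ofReal.comp
        (Finset.measurable_fun_prod _ fun i _ => (hA i).measurable_radialFunction)
    have hθm := hφ.symm.measurable_radialMap hh₀
    rw [dualMixedVolume, dualMixedVolume]
    refine (lintegral_mono' htr le_rfl).trans ?_
    rw [lintegral_map (hFm hA) hθm, lintegral_withDensity_eq_lintegral_mul _ hW
      (g := fun q => ENNReal.ofReal (∏ i, radialFunction (A i) (radialMap φ.symm h₀ q)))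
      ((hFm hA).comp hθm)]
    refine lintegral_mono fun q => ?_
    rw [Pi.mul_apply]
    by_cases hq : q.2 = 0
    · rw [show W q = 0 from if_pos hq, zero_mul]
      exact zero_le
    · have h0 := hh₀.pos _ (hφ.symm_map_mem hq)
      refine le_of_eq ?_
      rw [hWO q hq, radialMap_of_mem φ.symm h₀ hq, ← ENNReal.ofReal_mul (by positivity)]
      congr 1
      rw [Finset.prod_congr rfl fun i _ => (hA i).radialFunction_scaleCovector (one_div_pos.2 h0) _,
        Finset.prod_mul_distrib, Finset.prod_const, Finset.card_univ, Fintype.card_fin, ← mul_assoc,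
        ← mul_pow, mul_inv_cancel₀ (one_div_pos.2 h0).ne', one_pow, one_mul]
      exact Finset.prod_congr rfl fun i _ => (hφ.radialFunction_transformBody (hA i) hq).symm
  · have hp' := hφ.map_mem (hmem hh₀ hp)
    rw [mem_ofPred_eq, radialMap_of_mem φ h₁ (hmem hh₀ hp),
      hh₁.homogeneous _ _ (one_div_pos.2 (hpos p hp)), one_div_mul_cancel (hpos p hp).ne']
  · rw [radialMap_of_mem φ.symm h₀ (hψmem p (hmem hh₀ hp)), hval p hp, hsymm p (hmem hh₀ hp),
      scaleCovector_scaleCovector, one_div_mul_cancel (one_div_pos.2 (hpos p hp)).ne',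
      scaleCovector_one]
  · rw [hWval p hp]
    exact (ENNReal.ofReal_pos.2 (pow_pos (hpos p hp) n)).ne'
  · rw [hWval p hp]
    exact ENNReal.ofReal_ne_top
  · rw [hWval p hp, hφ.omegaForm_radialMap hn hh₁ (hmem hh₀ hp),
      ← ENNReal.ofReal_mul (pow_nonneg (hpos p hp).le n), abs_mul, ← mul_assoc,
      abs_of_nonneg (pow_nonneg (one_div_pos.2 (hpos p hp)).le n), ← mul_pow,
      mul_one_div_cancel (hpos p hp).ne', one_pow, one_mul]

end IsSpecialHomogeneous

theorem dualMixedVolume_mono {h₀ : CotangentBundle I M → ℝ} {A B : Fin n → Set (CotangentBundle I M)}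
    (hA : ∀ i, IsStarBody (A i)) (hB : ∀ i, IsStarBody (B i)) (hAB : ∀ i, A i ⊆ B i) :
    dualMixedVolume n h₀ A ≤ dualMixedVolume n h₀ B :=
  lintegral_mono fun p => ENNReal.ofReal_le_ofReal (Finset.prod_le_prod
    (fun i _ => (hA i).radialFunction_nonneg p)
    fun i _ => (hA i).radialFunction_mono (hB i) (hAB i) p)

end StarBodyTransform

end

theorem mainTheorem7
    {E : Type*} [NormedAddCommGroup E] [NormedSpace ℝ E] [FiniteDimensional ℝ E]
    {H : Type*} [TopologicalSpace H] (I : ModelWithCorners ℝ E H)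
    {M : Type*} [TopologicalSpace M] [ChartedSpace H M] [IsManifold I ∞ M]
    [CompactSpace M] [T2Space M]
    (n : ℕ) (hn : 1 ≤ n) (hdim : Module.finrank ℝ E = n)
    (φ : PartialEquiv (CotangentBundle I M) (CotangentBundle I M))
    (hφ : IsSpecialHomogeneous n φ) :
    -- `φ` maps star bodies to star bodies
    (∀ A : Set (CotangentBundle I M), IsStarBody A → IsStarBody (transformBody φ A)) ∧
    -- volumes of radial sums are preserved
    (∀ A B : Set (CotangentBundle I M), IsStarBody A → IsStarBody B →
      symplecticVolume n (radialSum A B) =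
        symplecticVolume n (radialSum (transformBody φ A) (transformBody φ B))) ∧
    -- dual mixed volumes are invariant, whatever model bodies they are computed with
    (∀ h₀ h₁ : CotangentBundle I M → ℝ,
      IsSmoothStarHamiltonian h₀ → IsSmoothStarHamiltonian h₁ →
      ∀ A : Fin n → Set (CotangentBundle I M), (∀ i, IsStarBody (A i)) →
        dualMixedVolume n h₀ A = dualMixedVolume n h₁ (fun i => transformBody φ (A i))) ∧
    -- monotonicity
    (∀ h₀ h₁ : CotangentBundle I M → ℝ,
      IsSmoothStarHamiltonian h₀ → IsSmoothStarHamiltonian h₁ →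
      ∀ A B : Fin n → Set (CotangentBundle I M),
        (∀ i, IsStarBody (A i)) → (∀ i, IsStarBody (B i)) →
        (∀ i, transformBody φ (A i) ⊆ B i) →
        dualMixedVolume n h₀ A ≤ dualMixedVolume n h₁ B) := by

  refine ⟨fun A hA => hφ.isStarBody hA, fun A B hA hB => ?_, fun h₀ h₁ hh₀ hh₁ A hA => ?_,
    fun h₀ h₁ hh₀ hh₁ A B hA hB hAB => ?_⟩
  · refine le_antisymm (hφ.symplecticVolume_radialSum_le hn hdim hA hB) ?_
    have h := hφ.symm.symplecticVolume_radialSum_le hn hdim (hφ.isStarBody hA) (hφ.isStarBody hB)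
    rwa [hφ.transformBody_symm hA, hφ.transformBody_symm hB] at h
  · refine le_antisymm (hφ.dualMixedVolume_le hn hh₀ hh₁ hA) ?_
    have h := hφ.symm.dualMixedVolume_le hn hh₁ hh₀ fun i => hφ.isStarBody (hA i)
    rwa [funext fun i => hφ.transformBody_symm (hA i)] at h
  · exact (hφ.dualMixedVolume_le hn hh₀ hh₁ hA).trans
      (dualMixedVolume_mono (fun i => hφ.isStarBody (hA i)) hB hAB)
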